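/- Let $R$ be a commutative noetherian local ring with maximal ideal $\mathfrak m$ and residue field $k=R/\mathfrak m$. Let $Q$ be a finite quiver with vertex set $Q_0$ and arrow set $Q_1$; write $t(a)$ and $h(a)$ for the tail and head of an arrow $a$. Let $RQ$ be the path algebra: it is free over $R$ on all paths (including the trivial paths $e_v$, $v\in Q_0$), and the product $pq$ of paths is the path "first $q$, then $p$" if the tail of $p$ is the head of $q$, and $0$ otherwise. Let $A_\ell\subseteq RQ$ be the $R$-span of the paths of length $\ell$, let $A=\bigoplus_{\ell\ge 1}A_\ell$, and let $\mathfrak m Q$ be the set of elements of $RQ$ with all coefficients in $\mathfrak m$. Let $I$ be a two-sided ideal of $RQ$, let $\Lambda=RQ/I$, and let $\mathcal J=\operatorname{rad}(\Lambda)$ be its Jacobson radical. The radical $\operatorname{rad}(M)$ of a module $M$ is the intersection of its maximal submodules. The ideal $I$ is called * *arrow-radical* if for every vertex $v$, $\sum_{t(a)=v}\Lambda a$ is the unique maximal left submodule of $\Lambda e_v$, and $\sum_{h(a)=v}a\Lambda$ is the unique maximal right submodule of $e_v\Lambda$; * *arrow-distinct* if for every arrow $a$, $\Lambda a\cap\sum_{b\ne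 a,\,t(b)=t(a)}\Lambda b\subseteq\operatorname{rad}(\Lambda a)$ and $a\Lambda\cap\sum_{b\neq a,\,h(b)=h(a)}b\Lambda\subseteq\operatorname{rad}(a\Lambda)$; * *permissible* if $a\notin I$ for every arrow $a$; * *bounded above* if $I\subseteq A+\mathfrak mQ$ and $I\cap A\subseteq A^2+(\mathfrak mQ\cap A)$; * *bounded below* if there are integers $m,n>0$ with $A^m\subseteq I+\mathfrak mQ$ and $\mathfrak mQ\subseteq I+\sum_{\ell=1}^nA_\ell$; * *admissible* if it is bounded above and bounded below. A ring $\Gamma$ with Jacobson radical $J$ is *semiperfect* if $\Gamma/J$ is semisimple artinian and idempotents lift modulo $J$; a semiperfect ring is *basic* if $\Gamma/J$ is isomorphic to a product of division rings. An idempotent $e\in\Gamma$ is *local* if $Je$ is the unique maximal submodule of the left module $\Gamma e$; idempotents $e,f$ are *isomorphic* if $\Gamma e\cong\Gamma f$. If $\Gamma$ is basic and semiperfect and the left $\Gamma$-module $J$ is finitely generated, the *Gabriel quiver* of $\Gamma$ has vertices $1,\dots,n$ corresponding to a complete orthogonal set $e_1,\dots,e_n$ of local idempotents, and the number of arrows $i\to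 j$ is the multiplicity of $\Gamma e_j$ as a direct summand of a projective cover of $Je_i$ (up to isomorphism this quiver does not depend on the choice of the set). **Theorem.** Suppose that $I$ is arrow-radical. Then: 1. $\Lambda$ is semiperfect and basic, and the elements $e_v+I$ ($v\in Q_0$) form a complete orthogonal family of pairwise non-isomorphic local idempotents of $\Lambda$. 2. $\Lambda$ is finitely generated as an $R$-module if and only if $I$ is bounded below. 3. If $I$ is arrow-distinct, then $I$ is permissible if and only if $I$ is bounded above. 4. If $I$ is bounded above, then $\Lambda/\mathcal J\cong k^{|Q_0|}$ as rings, and $\mathcal J/\mathcal J^2\cong k^{|Q_1|}$ as $k$-vector spaces (in particular $\mathfrak m$ annihilates $\mathcal J/\mathcal J^2$). 5. If $I$ is admissible and $R$ is $\mathfrak m$-adically complete, then $Q$ is (isomorphic to) the Gabriel quiver of $\Lambda$. -/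

import Mathlib

universe u v r

noncomputable section

/-! ### Path algebras -/

/-- A path in the quiver `V`, bundled with its tail (start) and head (end). -/
structure QPath (V : Type u) [Quiver.{v} V] where
  /-- the vertex at which the path starts -/
  tail : V
  /-- the vertex at which the path ends -/
  head : V
  /-- the underlying path -/
  path : Quiver.Path tail head

/-- An arrow of the quiver `V`, bundled with its tail and head. -/
structure QArrow (V : Type u) [Quiver.{v} V] where
  /-- the vertex at which the arrow starts -/
  tail : V
  /-- the vertex at which the arrow ends -/
  head : V
  /-- the underlying arrow -/
  hom : tail ⟶ head

instance (V : Type u) [Quiver.{v} V] [Fintype V] [∀ x y : V, Fintype (x ⟶ y)] :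
    Fintype (QArrow V) :=
  Fintype.ofEquiv (Σ x y : V, (x ⟶ y))
    { toFun := fun a => ⟨a.1, a.2.1, a.2.2⟩
      invFun := fun a => ⟨a.tail, a.head, a.hom⟩
      left_inv := fun _ => rfl
      right_inv := fun _ => rfl }

/-- The path algebra `RQ` of the quiver `Q` with vertex type `V`: the free `R`-module on the set
of all paths (including the trivial ones). -/
def PathAlgebra (R : Type r) [CommRing R] (V : Type u) [Quiver.{v} V] : Type (max u v r) :=
  QPath V →₀ R

namespace PathAlgebra

variable (R : Type r) [CommRing R] {V : Type u} [Quiver.{v} V]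

instance : AddCommGroup (PathAlgebra R V) := inferInstanceAs (AddCommGroup (QPath V →₀ R))

instance : Module R (PathAlgebra R V) := inferInstanceAs (Module R (QPath V →₀ R))

/-- The element of `RQ` given by a path. -/
def ofPath (p : QPath V) : PathAlgebra R V := Finsupp.single p (1 : R)

/-- The coefficient of a path in an element of `RQ`. -/
def coeff {R : Type r} [CommRing R] (p : QPath V) (x : PathAlgebra R V) : R :=
  (show QPath V →₀ R from x) p

/-- The trivial path `e_x` at the vertex `x`. -/
def triv (x : V) : PathAlgebra R V := ofPath R ⟨x, x, Quiver.Path.nil⟩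

/-- The element of `RQ` given by an arrow. -/
def arrow (a : QArrow V) : PathAlgebra R V := ofPath R ⟨a.tail, a.head, a.hom.toPath⟩

open Classical in
/-- The product `p q` of two paths, "first `q`, then `p`": it is the concatenated path if the tail
of `p` is the head of `q`, and `0` otherwise. -/
def pathMul (p q : QPath V) : PathAlgebra R V :=
  if h : q.head = p.tail then
    ofPath R ⟨q.tail, p.head, (q.path.cast rfl h).comp p.path⟩
  else 0

/-- The multiplication of `RQ`, as the bilinear extension of the product of paths. -/
def mulHom : PathAlgebra R V →ₗ[R] PathAlgebra R V →ₗ[R] PathAlgebra R V :=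
  Finsupp.linearCombination R (M := PathAlgebra R V →ₗ[R] PathAlgebra R V)
    fun p : QPath V => Finsupp.linearCombination R (M := PathAlgebra R V)
      fun q : QPath V => pathMul R p q

instance : Mul (PathAlgebra R V) := ⟨fun x y => mulHom R x y⟩

instance [Fintype V] : One (PathAlgebra R V) := ⟨∑ x : V, triv R x⟩

variable {R}

theorem mul_def (x y : PathAlgebra R V) : x * y = mulHom R x y := rfl

theorem one_def [Fintype V] : (1 : PathAlgebra R V) = ∑ x : V, triv R x := rfl

theorem mulHom_ofPath (p q : QPath V) :
    mulHom R (ofPath R p) (ofPath R q) = pathMul R p q := by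
  unfold mulHom ofPath
  erw [Finsupp.linearCombination_single, one_smul, Finsupp.linearCombination_single, one_smul]

/-- Induction principle: a property that is additive, and holds for `0` and for all multiples of
paths, holds for all elements of `RQ`. -/
theorem induction_on {P : PathAlgebra R V → Prop} (x : PathAlgebra R V) (zero : P 0)
    (add : ∀ x y, P x → P y → P (x + y)) (path : ∀ (c : R) p, P (c • ofPath R p)) : P x := by
  refine Finsupp.induction_linear (motive := P) x zero add fun p c => ?_
  have h : c • ofPath R p = (Finsupp.single p c : QPath V →₀ R) := by
    unfold ofPath
    erw [Finsupp.smul_single, smul_eq_mul, mul_one]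
  exact h ▸ path c p

theorem pathMul_of_eq {x y z : V} (p : Quiver.Path y z) (q : Quiver.Path x y) :
    pathMul R ⟨y, z, p⟩ ⟨x, y, q⟩ = ofPath R ⟨x, z, q.comp p⟩ := by
  simp [pathMul]

theorem pathMul_of_ne (p q : QPath V) (h : q.head ≠ p.tail) : pathMul R p q = 0 := by
  simp [pathMul, h]

theorem mulHom_assoc_ofPath (p q s : QPath V) :
    mulHom R (mulHom R (ofPath R p) (ofPath R q)) (ofPath R s)
      = mulHom R (ofPath R p) (mulHom R (ofPath R q) (ofPath R s)) := by
  obtain ⟨p₁, p₂, p⟩ := p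
  obtain ⟨q₁, q₂, q⟩ := q
  obtain ⟨s₁, s₂, s⟩ := s
  simp only [mulHom_ofPath]
  by_cases h : q₂ = p₁
  · subst h
    by_cases h' : s₂ = q₁
    · subst h'
      simp only [pathMul_of_eq, mulHom_ofPath, Quiver.Path.comp_assoc]
    · rw [pathMul_of_eq, pathMul_of_ne ⟨q₁, q₂, q⟩ ⟨s₁, s₂, s⟩ h', mulHom_ofPath,
        pathMul_of_ne _ _ h', map_zero]
  · rw [pathMul_of_ne ⟨p₁, p₂, p⟩ ⟨q₁, q₂, q⟩ h, map_zero, LinearMap.zero_apply]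
    by_cases h' : s₂ = q₁
    · subst h'
      rw [pathMul_of_eq, mulHom_ofPath, pathMul_of_ne _ _ h]
    · rw [pathMul_of_ne ⟨q₁, q₂, q⟩ ⟨s₁, s₂, s⟩ h', map_zero]

theorem mulHom_assoc (x y z : PathAlgebra R V) :
    mulHom R (mulHom R x y) z = mulHom R x (mulHom R y z) := by
  induction x using induction_on with
  | zero => simp only [map_zero, LinearMap.zero_apply]
  | add x x' hx hx' => simp only [map_add, LinearMap.add_apply, hx, hx']
  | path c p =>
    simp only [map_smul, LinearMap.smul_apply]
    congr 1
    induction y using induction_on with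
    | zero => simp only [map_zero, LinearMap.zero_apply]
    | add y y' hy hy' => simp only [map_add, LinearMap.add_apply, hy, hy']
    | path d q =>
      simp only [map_smul, LinearMap.smul_apply]
      congr 1
      induction z using induction_on with
      | zero => simp only [map_zero]
      | add z z' hz hz' => simp only [map_add, hz, hz']
      | path e s => simp only [map_smul, mulHom_assoc_ofPath]

theorem one_mulHom [Fintype V] (x : PathAlgebra R V) : mulHom R (∑ y : V, triv R y) x = x := by
  induction x using induction_on with
  | zero => simp only [map_zero]
  | add x x' hx hx' => simp only [map_add, hx, hx']
  | path c p =>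
    obtain ⟨p₁, p₂, p⟩ := p
    rw [map_smul, map_sum, LinearMap.sum_apply, Finset.sum_eq_single p₂]
    · rw [triv, mulHom_ofPath, pathMul_of_eq, Quiver.Path.comp_nil]
    · intro y _ hy
      rw [triv, mulHom_ofPath, pathMul_of_ne _ _ hy.symm]
    · exact fun h => absurd (Finset.mem_univ _) h

theorem mulHom_one [Fintype V] (x : PathAlgebra R V) : mulHom R x (∑ y : V, triv R y) = x := by
  induction x using induction_on with
  | zero => simp only [map_zero, LinearMap.zero_apply]
  | add x x' hx hx' => simp only [map_add, LinearMap.add_apply, hx, hx']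
  | path c p =>
    obtain ⟨p₁, p₂, p⟩ := p
    rw [map_smul, LinearMap.smul_apply, map_sum, Finset.sum_eq_single p₁]
    · rw [triv, mulHom_ofPath, pathMul_of_eq, Quiver.Path.nil_comp]
    · intro y _ hy
      rw [triv, mulHom_ofPath, pathMul_of_ne _ _ hy]
    · exact fun h => absurd (Finset.mem_univ _) h

instance [Fintype V] : Ring (PathAlgebra R V) :=
  { (inferInstance : AddCommGroup (PathAlgebra R V)) with
    mul := (· * ·)
    one := 1
    left_distrib := fun x y z => map_add (mulHom R x) y z
    right_distrib := fun x y z => by simp only [mul_def, map_add, LinearMap.add_apply]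
    zero_mul := fun x => by simp only [mul_def, map_zero, LinearMap.zero_apply]
    mul_zero := fun x => map_zero (mulHom R x)
    mul_assoc := mulHom_assoc
    one_mul := one_mulHom
    mul_one := mulHom_one }

instance [Fintype V] : Algebra R (PathAlgebra R V) :=
  Algebra.ofModule
    (fun c x y => by simp only [mul_def, map_smul, LinearMap.smul_apply])
    (fun c x y => map_smul (mulHom R x) c y)

end PathAlgebra

/-! ### Submodules of the path algebra, and bounded ideals -/

section Bounded

variable (R : Type r) [CommRing R] (V : Type u) [Quiver.{v} V]

/-- `A_ℓ`: the `R`-span of the paths of length `ℓ`. -/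
def pathsOfLength (l : ℕ) : Submodule R (PathAlgebra R V) :=
  Submodule.span R {x | ∃ p : QPath V, p.path.length = l ∧ x = PathAlgebra.ofPath R p}

/-- `A = ⨁_{ℓ ≥ 1} A_ℓ`: the `R`-span of the non-trivial paths. -/
def arrowIdeal : Submodule R (PathAlgebra R V) :=
  ⨆ l ≥ 1, pathsOfLength R V l

/-- `𝔪Q`: the elements of `RQ` all of whose coefficients lie in the maximal ideal of `R`. -/
def maxCoeff [IsLocalRing R] : Submodule R (PathAlgebra R V) where
  carrier := {x | ∀ p : QPath V, x.coeff p ∈ IsLocalRing.maximalIdeal R}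
  zero_mem' := fun _ => zero_mem (IsLocalRing.maximalIdeal R)
  add_mem' := fun hx hy p => add_mem (hx p) (hy p)
  smul_mem' := fun c _ hx p => (IsLocalRing.maximalIdeal R).mul_mem_left c (hx p)

variable {R V} [Fintype V] [IsLocalRing R] (I : Ideal (PathAlgebra R V))

/-- `I` is bounded above: `I ⊆ A + 𝔪Q` and `I ∩ A ⊆ A² + (𝔪Q ∩ A)`. -/
def IsBoundedAbove : Prop :=
  I.restrictScalars R ≤ arrowIdeal R V ⊔ maxCoeff R V ∧
  I.restrictScalars R ⊓ arrowIdeal R V ≤ arrowIdeal R V ^ 2 ⊔ (maxCoeff R V ⊓ arrowIdeal R V)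

/-- `I` is bounded below: `A^m ⊆ I + 𝔪Q` and `𝔪Q ⊆ I + A_1 + ⋯ + A_n` for some `m, n > 0`. -/
def IsBoundedBelow : Prop :=
  ∃ m n : ℕ, 0 < m ∧ 0 < n ∧
    arrowIdeal R V ^ m ≤ I.restrictScalars R ⊔ maxCoeff R V ∧
    maxCoeff R V ≤ I.restrictScalars R ⊔ ⨆ l ∈ Finset.Icc 1 n, pathsOfLength R V l

/-- `I` is admissible if it is bounded above and bounded below. -/
def IsAdmissibleIdeal : Prop := IsBoundedAbove I ∧ IsBoundedBelow I

end Bounded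

/-! ### Radicals, local idempotents, semiperfect and basic rings -/

/-- `N` is the unique maximal submodule of the submodule `M`. Here `L ⋖ M` says that `L` is a
maximal (proper) submodule of `M`. -/
def IsUniqueMaximalSubmodule {S : Type*} {X : Type*} [Ring S] [AddCommGroup X] [Module S X]
    (N M : Submodule S X) : Prop :=
  ∀ L : Submodule S X, L ⋖ M ↔ L = N

/-- The radical `rad M` (the intersection of the maximal submodules of `M`) of a submodule `M`
of `X`, as a submodule of `X`. -/
def radicalOf {S : Type*} {X : Type*} [Ring S] [AddCommGroup X] [Module S X]
    (M : Submodule S X) : Submodule S X :=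
  (Module.jacobson S M).map M.subtype

section Rings

variable {Λ : Type*} [Ring Λ]

/-- The left submodule `Λ x` of `Λ`. -/
def leftSpan (x : Λ) : Submodule Λ Λ := Submodule.span Λ {x}

/-- The right submodule `x Λ` of `Λ`. -/
def rightSpan (x : Λ) : Submodule Λᵐᵒᵖ Λ := Submodule.span Λᵐᵒᵖ {x}

/-- The left submodule `J x` of `Λ`, where `J` is the Jacobson radical of `Λ`. -/
def jacobsonMul (x : Λ) : Submodule Λ Λ :=
  (Ring.jacobson Λ).map (LinearMap.toSpanSingleton Λ Λ x)

/-- An idempotent `e` is local if `J e` is the unique maximal submodule of `Λ e`. -/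
def IsLocalIdempotent (e : Λ) : Prop :=
  IsIdempotentElem e ∧ IsUniqueMaximalSubmodule (jacobsonMul e) (leftSpan e)

/-- Idempotents `e`, `f` are isomorphic if `Λ e ≅ Λ f` as left modules. -/
def IsomorphicIdempotents (e f : Λ) : Prop :=
  Nonempty (leftSpan e ≃ₗ[Λ] leftSpan f)

variable (Λ)

/-- The quotient `J / J²`, where `J` is the Jacobson radical of `Λ`. -/
abbrev RadicalLayer : Type _ :=
  Ring.jacobson Λ ⧸ (Ring.jacobson Λ * Ring.jacobson Λ).submoduleOf (Ring.jacobson Λ)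

/-- `Λ` is semiperfect: `Λ / J` is semisimple (artinian), and idempotents lift modulo `J`. -/
def IsSemiperfectRing : Prop :=
  IsSemisimpleRing (Λ ⧸ Ring.jacobson Λ) ∧
  ∀ x : Λ, x * x - x ∈ Ring.jacobson Λ → ∃ f : Λ, IsIdempotentElem f ∧ x - f ∈ Ring.jacobson Λ

end Rings

/-- `Λ / J` is isomorphic to a (finite) product of division rings. -/
def IsBasicRing (Λ : Type u) [Ring Λ] : Prop :=
  ∃ (n : ℕ) (D : Fin n → Type u) (_ : ∀ i, DivisionRing (D i)),
    Nonempty ((Λ ⧸ Ring.jacobson Λ) ≃+* ((i : Fin n) → D i))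

/-- A linear map `f : P → M` is a projective cover: `P` is projective, `f` is surjective, and the
kernel of `f` is superfluous. -/
def IsProjectiveCover {S : Type*} {P : Type*} {M : Type*} [Ring S] [AddCommGroup P] [Module S P]
    [AddCommGroup M] [Module S M] (f : P →ₗ[S] M) : Prop :=
  Module.Projective S P ∧ Function.Surjective f ∧
    ∀ N : Submodule S P, LinearMap.ker f ⊔ N = ⊤ → N = ⊤

/-- The quiver `V` is the Gabriel quiver of the semiperfect basic ring `Λ`: the vertices correspond
to a complete orthogonal set of local idempotents `e_x` of `Λ`, and for all vertices `x`, `y` the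
number of arrows from `x` to `y` is the multiplicity of `Λ e_y` as a summand of a projective
cover of `J e_x` (these multiplicities do not depend on the choice of the idempotents, up to
renumbering). That is, `J e_x` has a projective cover by the direct sum over all `y` of copies
of `Λ e_y`, one copy for each arrow `x ⟶ y`. -/
def IsGabrielQuiver (Λ : Type*) [Ring Λ] (V : Type u) [Quiver.{v} V] [Fintype V]
    [∀ x y : V, Fintype (x ⟶ y)] : Prop :=
  IsSemiperfectRing Λ ∧ IsBasicRing Λ ∧
  ∃ e : V → Λ, CompleteOrthogonalIdempotents e ∧ (∀ x, IsLocalIdempotent (e x)) ∧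
    ∀ x : V, ∃ f : ((y : V) → (x ⟶ y) → leftSpan (e y)) →ₗ[Λ] jacobsonMul (e x),
      IsProjectiveCover f

/-! ### Conditions on ideals of the path algebra -/

section Conditions

variable {R : Type r} [CommRing R] {V : Type u} [Quiver.{v} V] [Fintype V]
  (I : Ideal (PathAlgebra R V)) [I.IsTwoSided]

/-- The image `e_x + I` in `RQ / I` of the trivial path at `x`. -/
def quotTriv (x : V) : PathAlgebra R V ⧸ I := Ideal.Quotient.mk I (PathAlgebra.triv R x)

/-- The image `a + I` in `RQ / I` of an arrow. -/
def quotArrow (a : QArrow V) : PathAlgebra R V ⧸ I := Ideal.Quotient.mk I (PathAlgebra.arrow R a)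

/-- `I` is permissible: no arrow lies in `I`. -/
def IsPermissible : Prop := ∀ a : QArrow V, PathAlgebra.arrow R a ∉ I

/-- `I` is arrow-radical: with `Λ = RQ / I`, for each vertex `x`, the sum of the `Λ a` over the
arrows `a` with tail `x` is the unique maximal left submodule of `Λ e_x`, and the sum of the
`a Λ` over the arrows `a` with head `x` is the unique maximal right submodule of `e_x Λ`. -/
def IsArrowRadical : Prop :=
  ∀ x : V,
    IsUniqueMaximalSubmodule (⨆ (a : QArrow V) (_ : a.tail = x), leftSpan (quotArrow I a))
      (leftSpan (quotTriv I x)) ∧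
    IsUniqueMaximalSubmodule (⨆ (a : QArrow V) (_ : a.head = x), rightSpan (quotArrow I a))
      (rightSpan (quotTriv I x))

/-- `I` is arrow-distinct: with `Λ = RQ / I`, for each arrow `a`, the intersection of `Λ a` with
the sum of the `Λ b` over the arrows `b ≠ a` with the same tail as `a` lies in `rad (Λ a)`, and the
intersection of `a Λ` with the sum of the `b Λ` over the arrows `b ≠ a` with the same head as
`a` lies in `rad (a Λ)`. -/
def IsArrowDistinct : Prop :=
  ∀ a : QArrow V,
    leftSpan (quotArrow I a) ⊓
        (⨆ (b : QArrow V) (_ : b ≠ a ∧ b.tail = a.tail), leftSpan (quotArrow I b))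
      ≤ radicalOf (leftSpan (quotArrow I a)) ∧
    rightSpan (quotArrow I a) ⊓
        (⨆ (b : QArrow V) (_ : b ≠ a ∧ b.head = a.head), rightSpan (quotArrow I b))
      ≤ radicalOf (rightSpan (quotArrow I a))

end Conditions

end

noncomputable section

/-! ### The length grading of the path algebra -/

namespace PathAlgebra

variable {R : Type r} [CommRing R] {V : Type u} [Quiver.{v} V]

/-! Everything rests on identifying the radical `J` of `Λ = RQ/I` with the image of `A`. The unique
maximal submodule of a submodule of `Λ` lies in every maximal left ideal that does not contain that
submodule, hence in `J`; so arrow-radicality puts every arrow, and then the image of `A`, inside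
`J`. No `e_x` lies in `J`, so maximality of `∑ Λ a` in `Λ e_x` forces it to equal `J e_x`
(`arrowsFrom_eq_jacobsonMul`) and to contain `𝔪 e_x` (`smul_quotTriv_mem_arrowsFrom`). Since `RQ =
A_0 + A`, it follows that `J` is the image of `A` and contains `𝔪Λ`, and that `Λ/J` is `k^V` with
the `e_x` as coordinate idempotents. Idempotents of `k^V` have entries `0` and `1`, so they lift to
sums of vertices.

Finiteness: if `I` is bounded below, finitely many `A_l` span `Λ` over `R`. Conversely, if `Λ` is
finite over `R`, then `Λ/𝔪Λ` is artinian and noetherian over `Λ`, so `J` acts nilpotently on it by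
Nakayama; and `𝔪Λ ⊆ J` is finitely generated, hence covered by finitely many of the images of `A_1,
A_2, …`.

For the remaining claims, `J²` is the image of `A²`, and elements of `A²` have zero arrow
coefficients. Boundedness above therefore says that an `R`-combination of arrows falling into `J²`
has its coefficients in `𝔪` (`coeff_arrow_mem_maximalIdeal`). This makes the arrows a `k`-basis of
`J/J²`, keeps arrows out of `I`, and shows that right multiplication by the arrows out of `x`, a map
from a sum of modules `Λ e_y` onto `J e_x`, has kernel inside `J` times its source, so it is a
projective cover. For the converse in the arrow-distinct case, a unit coefficient at `a` in a
relation lets one solve for `a` in terms of the other arrows with the same tail; then `a` lies in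
`rad (Λ a)`, and Nakayama gives `a = 0` in `Λ`. -/

theorem ofPath_mul_ofPath {x y z : V} (p : Quiver.Path y z) (q : Quiver.Path x y) :
    (ofPath R ⟨y, z, p⟩ : PathAlgebra R V) * ofPath R ⟨x, y, q⟩ = ofPath R ⟨x, z, q.comp p⟩ := by
  rw [mul_def, mulHom_ofPath, pathMul_of_eq]

theorem ofPath_mul_ofPath_of_ne (p q : QPath V) (h : q.head ≠ p.tail) :
    (ofPath R p : PathAlgebra R V) * ofPath R q = 0 := by
  rw [mul_def, mulHom_ofPath, pathMul_of_ne _ _ h]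

theorem triv_mul_triv_self (x : V) : triv R x * triv R x = triv R x := by
  rw [triv, ofPath_mul_ofPath, Quiver.Path.comp_nil]

theorem triv_mul_triv_of_ne {x y : V} (h : x ≠ y) : triv R x * triv R y = 0 :=
  ofPath_mul_ofPath_of_ne _ _ h.symm

theorem arrow_mul_triv_tail (a : QArrow V) : arrow R a * triv R a.tail = arrow R a := by
  rw [arrow, triv, ofPath_mul_ofPath, Quiver.Path.nil_comp]

theorem arrow_mul_triv_of_ne {a : QArrow V} {x : V} (h : a.tail ≠ x) :
    arrow R a * triv R x = 0 :=
  ofPath_mul_ofPath_of_ne _ _ h.symm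

theorem triv_head_mul_arrow (a : QArrow V) : triv R a.head * arrow R a = arrow R a := by
  rw [arrow, triv, ofPath_mul_ofPath, Quiver.Path.comp_nil]

/-- The coefficient of a path, as a linear functional. -/
def coeffLin (p : QPath V) : PathAlgebra R V →ₗ[R] R := Finsupp.lapply p

theorem coeffLin_apply (p : QPath V) (x : PathAlgebra R V) : coeffLin p x = x.coeff p := rfl

theorem coeff_ofPath_self (p : QPath V) : (ofPath R p).coeff p = 1 :=
  Finsupp.single_eq_same

theorem coeff_ofPath_of_ne {p q : QPath V} (h : p ≠ q) : (ofPath R p).coeff q = 0 :=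
  Finsupp.single_eq_of_ne h.symm

theorem mem_span_range_ofPath (x : PathAlgebra R V) :
    x ∈ Submodule.span R (Set.range (ofPath R : QPath V → PathAlgebra R V)) := by
  induction x using induction_on with
  | zero => exact zero_mem _
  | add x y hx hy => exact add_mem hx hy
  | path c p => exact Submodule.smul_mem _ c (Submodule.subset_span ⟨p, rfl⟩)

end PathAlgebra

open PathAlgebra

section Grading

variable {R : Type r} [CommRing R] {V : Type u} [Quiver.{v} V]

theorem ofPath_mem_pathsOfLength (p : QPath V) :
    ofPath R p ∈ pathsOfLength R V p.path.length :=
  Submodule.subset_span ⟨p, rfl, rfl⟩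

theorem arrow_mem_pathsOfLength_one (a : QArrow V) : arrow R a ∈ pathsOfLength R V 1 :=
  ofPath_mem_pathsOfLength (R := R) ⟨a.tail, a.head, a.hom.toPath⟩

theorem triv_mem_pathsOfLength_zero (x : V) : triv R x ∈ pathsOfLength R V 0 :=
  ofPath_mem_pathsOfLength (R := R) ⟨x, x, .nil⟩

theorem coeff_arrow_self (a : QArrow V) :
    (arrow R a).coeff ⟨a.tail, a.head, a.hom.toPath⟩ = 1 :=
  coeff_ofPath_self _

theorem coeff_arrow_of_ne {a b : QArrow V} (hb : b ≠ a) :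
    (arrow R b).coeff ⟨a.tail, a.head, a.hom.toPath⟩ = 0 := by
  refine coeff_ofPath_of_ne ?_
  obtain ⟨x, y, f⟩ := a
  obtain ⟨x', y', f'⟩ := b
  intro h
  simp only [QPath.mk.injEq] at h
  obtain ⟨rfl, rfl, h⟩ := h
  exact hb (by rw [Quiver.Path.hom_heq_of_cons_eq_cons (eq_of_heq h) |> eq_of_heq])

theorem iSup_pathsOfLength : ⨆ l, pathsOfLength R V l = ⊤ := by
  rw [eq_top_iff]
  intro x _
  refine Submodule.span_le.2 ?_ (mem_span_range_ofPath x)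
  rintro _ ⟨p, rfl⟩
  exact Submodule.mem_iSup_of_mem _ (ofPath_mem_pathsOfLength p)

theorem coeff_eq_zero_of_mem_pathsOfLength {l : ℕ} {x : PathAlgebra R V}
    (hx : x ∈ pathsOfLength R V l) {p : QPath V} (hp : p.path.length ≠ l) : x.coeff p = 0 := by
  suffices h : pathsOfLength R V l ≤ LinearMap.ker (coeffLin p) from h hx
  refine Submodule.span_le.2 ?_
  rintro _ ⟨q, rfl, rfl⟩
  exact coeff_ofPath_of_ne fun h => hp (h ▸ rfl)

theorem pathsOfLength_zero_eq_span :
    pathsOfLength R V 0 = Submodule.span R (Set.range (triv R : V → PathAlgebra R V)) := by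
  refine le_antisymm (Submodule.span_mono ?_) (Submodule.span_le.2 ?_)
  · rintro _ ⟨⟨x, y, p⟩, hp, rfl⟩
    cases p with
    | nil => exact ⟨x, rfl⟩
    | cons p e => simp at hp
  · rintro _ ⟨x, rfl⟩
    exact triv_mem_pathsOfLength_zero x

theorem pathsOfLength_one_eq_span :
    pathsOfLength R V 1 = Submodule.span R (Set.range (arrow R : QArrow V → PathAlgebra R V)) := by
  refine le_antisymm (Submodule.span_mono ?_) (Submodule.span_le.2 ?_)
  · rintro _ ⟨⟨x, y, p⟩, hp, rfl⟩
    obtain ⟨z, f, q, hq, rfl⟩ := p.eq_toPath_comp_of_length_eq_succ hp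
    cases q with
    | nil => exact ⟨⟨x, _, f⟩, rfl⟩
    | cons p e => simp at hq
  · rintro _ ⟨x, rfl⟩
    exact arrow_mem_pathsOfLength_one x

theorem pathsOfLength_le_arrowIdeal {l : ℕ} (hl : 1 ≤ l) :
    pathsOfLength R V l ≤ arrowIdeal R V :=
  le_iSup₂_of_le l hl le_rfl

theorem pathsOfLength_zero_sup_arrowIdeal : pathsOfLength R V 0 ⊔ arrowIdeal R V = ⊤ := by
  rw [eq_top_iff, ← iSup_pathsOfLength]
  refine iSup_le fun l => ?_
  rcases Nat.eq_zero_or_pos l with rfl | hl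
  · exact le_sup_left
  · exact (pathsOfLength_le_arrowIdeal hl).trans le_sup_right

variable [Fintype V]

theorem pathsOfLength_mul_le (l m : ℕ) :
    pathsOfLength R V l * pathsOfLength R V m ≤ pathsOfLength R V (l + m) := by
  rw [pathsOfLength, pathsOfLength, Submodule.span_mul_span, Submodule.span_le]
  rintro _ ⟨_, ⟨⟨y, z, p⟩, rfl, rfl⟩, _, ⟨⟨x, y', q⟩, rfl, rfl⟩, rfl⟩
  by_cases h : y' = y
  · subst h
    refine Submodule.subset_span ⟨⟨x, z, q.comp p⟩, ?_, ofPath_mul_ofPath p q⟩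
    simp [add_comm]
  · simp only [SetLike.mem_coe]
    rw [ofPath_mul_ofPath_of_ne ⟨y, z, p⟩ ⟨x, y', q⟩ h]
    exact zero_mem _

theorem pathsOfLength_succ (l : ℕ) :
    pathsOfLength R V (l + 1) = pathsOfLength R V l * pathsOfLength R V 1 := by
  refine le_antisymm (Submodule.span_le.2 ?_) (pathsOfLength_mul_le l 1)
  rintro _ ⟨⟨x, y, p⟩, hp, rfl⟩
  obtain ⟨c, f, q, rfl, rfl⟩ := p.eq_toPath_comp_of_length_eq_succ hp
  rw [SetLike.mem_coe, ← ofPath_mul_ofPath]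
  exact Submodule.mul_mem_mul (ofPath_mem_pathsOfLength (R := R) ⟨c, y, q⟩)
    (arrow_mem_pathsOfLength_one (R := R) (V := V) ⟨x, c, f⟩)

/-- Splitting off the first arrow of a nontrivial path puts that arrow on the right, so `A` is
generated by the arrows as a left ideal. -/
theorem arrowIdeal_eq_top_mul : arrowIdeal R V = ⊤ * pathsOfLength R V 1 := by
  rw [← iSup_pathsOfLength, Submodule.iSup_mul, arrowIdeal]
  simp_rw [← pathsOfLength_succ]
  refine le_antisymm (iSup₂_le fun l hl => ?_)
    (iSup_le fun l => le_iSup₂_of_le (l + 1) (by lia) le_rfl)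
  obtain ⟨l, rfl⟩ := Nat.exists_eq_add_of_le' hl
  exact le_iSup_of_le l le_rfl

theorem arrowIdeal_mul_top_le : arrowIdeal R V * ⊤ ≤ arrowIdeal R V := by
  rw [← iSup_pathsOfLength, Submodule.mul_iSup]
  refine iSup_le fun m => ?_
  conv_lhs => rw [arrowIdeal]
  simp_rw [Submodule.iSup_mul]
  exact iSup₂_le fun l hl =>
    (pathsOfLength_mul_le l m).trans (pathsOfLength_le_arrowIdeal (by lia))

theorem arrowIdeal_mul_self_le :
    arrowIdeal R V * arrowIdeal R V ≤ arrowIdeal R V * pathsOfLength R V 1 := by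
  conv_lhs => enter [2]; rw [arrowIdeal_eq_top_mul]
  rw [← mul_assoc]
  exact mul_le_mul' arrowIdeal_mul_top_le le_rfl

theorem arrowIdeal_le_sup :
    arrowIdeal R V ≤ pathsOfLength R V 1 ⊔ arrowIdeal R V * arrowIdeal R V := by
  conv_lhs => rw [arrowIdeal_eq_top_mul, ← pathsOfLength_zero_sup_arrowIdeal, Submodule.sup_mul]
  exact sup_le_sup ((pathsOfLength_mul_le 0 1).trans_eq (by rw [zero_add]))
    (mul_le_mul' le_rfl (pathsOfLength_le_arrowIdeal le_rfl))

/-- Products of two nontrivial paths have length at least 2. This lets arrow coefficients detect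
elements modulo `A²`. -/
theorem coeff_arrow_eq_zero_of_mem_sq {x : PathAlgebra R V} (hx : x ∈ arrowIdeal R V ^ 2)
    (a : QArrow V) : x.coeff ⟨a.tail, a.head, a.hom.toPath⟩ = 0 := by
  suffices h : arrowIdeal R V * arrowIdeal R V ≤
      LinearMap.ker (coeffLin (⟨a.tail, a.head, a.hom.toPath⟩ : QPath V)) from
    h (pow_two (arrowIdeal R V) ▸ hx)
  conv_lhs => rw [arrowIdeal]
  simp_rw [Submodule.iSup_mul, Submodule.mul_iSup]
  refine iSup₂_le fun l hl => iSup₂_le fun m hm => (pathsOfLength_mul_le l m).trans fun y hy => ?_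
  refine coeff_eq_zero_of_mem_pathsOfLength hy ?_
  change 1 ≠ l + m
  lia

theorem pathsOfLength_le_arrowIdeal_pow {m l : ℕ} (hm : 0 < m) (hl : m ≤ l) :
    pathsOfLength R V l ≤ arrowIdeal R V ^ m := by
  induction m, hm using Nat.le_induction generalizing l with
  | base => rw [pow_one]; exact pathsOfLength_le_arrowIdeal hl
  | succ m hm ih =>
    obtain ⟨l, rfl⟩ := Nat.exists_eq_add_of_le' (show 1 ≤ l by lia)
    rw [pathsOfLength_succ, pow_succ]
    exact mul_le_mul' (ih (by lia)) (pathsOfLength_le_arrowIdeal le_rfl)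

theorem pathsOfLength_fg [∀ x y : V, Fintype (x ⟶ y)] (l : ℕ) : (pathsOfLength R V l).FG := by
  induction l with
  | zero =>
    rw [pathsOfLength_zero_eq_span]
    exact Submodule.fg_span (Set.finite_range _)
  | succ l ih =>
    rw [pathsOfLength_succ, pathsOfLength_one_eq_span]
    exact ih.mul (Submodule.fg_span (Set.finite_range _))

theorem exists_eq_sum_triv_add (x : PathAlgebra R V) :
    ∃ c : V → R, ∃ y ∈ arrowIdeal R V, x = ∑ z, c z • triv R z + y := by
  have hx : x ∈ pathsOfLength R V 0 ⊔ arrowIdeal R V := by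
    rw [pathsOfLength_zero_sup_arrowIdeal]
    exact Submodule.mem_top
  obtain ⟨w, hw, y, hy, rfl⟩ := Submodule.mem_sup.1 hx
  rw [pathsOfLength_zero_eq_span, Submodule.mem_span_range_iff_exists_fun] at hw
  obtain ⟨c, rfl⟩ := hw
  exact ⟨c, y, hy, rfl⟩

variable [∀ x y : V, Fintype (x ⟶ y)]

theorem exists_eq_sum_mul_arrow {S : Submodule R (PathAlgebra R V)} {x : PathAlgebra R V}
    (hx : x ∈ S * pathsOfLength R V 1) :
    ∃ c : QArrow V → PathAlgebra R V, (∀ a, c a ∈ S) ∧ x = ∑ a, c a * arrow R a := by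
  refine Submodule.mul_induction_on hx (fun s hs y hy => ?_) ?_
  · rw [pathsOfLength_one_eq_span, Submodule.mem_span_range_iff_exists_fun] at hy
    obtain ⟨c, rfl⟩ := hy
    refine ⟨fun a => c a • s, fun a => S.smul_mem _ hs, ?_⟩
    simp_rw [Finset.mul_sum, mul_smul_comm, smul_mul_assoc]
  · rintro _ _ ⟨c, hc, rfl⟩ ⟨d, hd, rfl⟩
    refine ⟨c + d, fun a => add_mem (hc a) (hd a), ?_⟩
    simp_rw [Pi.add_apply, add_mul, Finset.sum_add_distrib]

theorem exists_eq_sum_arrow_add {x : PathAlgebra R V} (hx : x ∈ arrowIdeal R V) :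
    ∃ c : QArrow V → R, ∃ y ∈ arrowIdeal R V * arrowIdeal R V, x = ∑ a, c a • arrow R a + y := by
  obtain ⟨w, hw, y, hy, rfl⟩ := Submodule.mem_sup.1 (arrowIdeal_le_sup hx)
  rw [pathsOfLength_one_eq_span, Submodule.mem_span_range_iff_exists_fun] at hw
  obtain ⟨c, rfl⟩ := hw
  exact ⟨c, y, hy, rfl⟩

theorem coeff_sum_arrow (c : QArrow V → R) (a : QArrow V) :
    (∑ b, c b • arrow R b : PathAlgebra R V).coeff ⟨a.tail, a.head, a.hom.toPath⟩ = c a := by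
  rw [← coeffLin_apply, map_sum, Finset.sum_eq_single a]
  · rw [map_smul, coeffLin_apply, coeff_arrow_self, smul_eq_mul, mul_one]
  · intro b _ hb
    rw [map_smul, coeffLin_apply, coeff_arrow_of_ne hb, smul_zero]
  · exact fun h => absurd (Finset.mem_univ _) h

end Grading

/-- The form `𝔪 • ⊤`, unlike the coefficientwise one, is carried along by the quotient map to `Λ`.
-/
theorem maxCoeff_eq_smul_top (R : Type r) [CommRing R] [IsLocalRing R] (V : Type u)
    [Quiver.{v} V] :
    maxCoeff R V = IsLocalRing.maximalIdeal R • (⊤ : Submodule R (PathAlgebra R V)) := by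
  refine le_antisymm (fun x hx => ?_) (Submodule.smul_le.2 fun c hc x _ p =>
    Ideal.mul_mem_right _ _ hc)
  obtain ⟨c, rfl⟩ := Finsupp.mem_span_range_iff_exists_finsupp.1 (mem_span_range_ofPath x)
  refine Submodule.sum_mem _ fun p hp => Submodule.smul_mem_smul ?_ Submodule.mem_top
  convert! hx p
  rw [← coeffLin_apply, map_finsuppSum, Finsupp.sum, Finset.sum_eq_single_of_mem p hp]
  · rw [map_smul, coeffLin_apply, coeff_ofPath_self, smul_eq_mul, mul_one]
  · intro q _ hq
    rw [map_smul, coeffLin_apply, coeff_ofPath_of_ne hq, smul_zero]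

/-! ### Jacobson radicals -/

section Jacobson

/-- A maximal `L` either contains `M`, or meets it in a maximal submodule of `M`, which can only be
`N`. This is how a condition on `Λ e_x` alone controls the radical of all of `Λ`. -/
theorem le_jacobson_of_isUniqueMaximalSubmodule {S : Type*} {X : Type*} [Ring S] [AddCommGroup X]
    [Module S X] {N M : Submodule S X} (h : IsUniqueMaximalSubmodule N M) :
    N ≤ Module.jacobson S X := by
  refine le_sInf fun L (hL : IsCoatom L) => ?_
  by_cases hM : M ≤ L
  · exact (((h N).2 rfl).le).trans hM
  · have htop : L ⊔ M = ⊤ := hL.2 _ (left_lt_sup.2 hM)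
    -- Modularity: `M / (L ⊓ M)` is isomorphic to the simple quotient by `L`.
    have hcov : L ⊓ M ⋖ M := IsLowerModularLattice.inf_covBy_of_covBy_sup (htop ▸ hL.covBy_top)
    exact ((h _).1 hcov).symm.le.trans inf_le_left

/-- A proper left ideal containing `y` would lie in a maximal one, which then contains the unit `x`.
Only a left inverse is produced, which is all that is needed. -/
theorem isUnit_of_sub_mem_jacobson {S : Type*} [Ring S] {x y : S} (hx : IsUnit x)
    (h : x - y ∈ Ring.jacobson S) : ∃ z, z * y = 1 := by
  obtain ⟨u, rfl⟩ := hx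
  by_contra! hz
  have hne : (Ideal.span {y} : Ideal S) ≠ ⊤ := fun ht => by
    obtain ⟨z, hz'⟩ := Ideal.mem_span_singleton'.1 (ht ▸ Submodule.mem_top : (1 : S) ∈ Ideal.span {y})
    exact hz z hz'
  obtain ⟨m, hm, hle⟩ := Ideal.exists_le_maximal _ hne
  have hu : (u : S) ∈ m := by
    have := m.add_mem (Ring.jacobson_le_of_isMaximal m h) (hle (Ideal.mem_span_singleton_self y))
    rwa [sub_add_cancel] at this
  exact hm.ne_top (m.eq_top_of_isUnit_mem hu u.isUnit)

theorem IsIdempotentElem.eq_zero_of_mem_jacobson {S : Type*} [Ring S] {e : S}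
    (he : IsIdempotentElem e) (h : e ∈ Ring.jacobson S) : e = 0 := by
  obtain ⟨z, hz⟩ := isUnit_of_sub_mem_jacobson (y := 1 - e) isUnit_one (by simpa using h)
  calc e = z * (1 - e) * e := by rw [hz, one_mul]
    _ = 0 := by rw [mul_assoc, sub_mul, he.eq, one_mul, sub_self, mul_zero]

/-- If the generator lies in the radical, the cyclic module equals its own radical, which is
impossible for a nonzero finitely generated module. -/
theorem eq_zero_of_mem_radicalOf_leftSpan {S : Type*} [Ring S] {x : S}
    (h : x ∈ radicalOf (leftSpan x)) : x = 0 := by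
  by_contra hx
  have : Nontrivial (leftSpan x) :=
    ⟨⟨⟨x, Submodule.mem_span_singleton_self x⟩, 0, fun h => hx (congrArg Subtype.val h)⟩⟩
  have : Module.Finite S (leftSpan x) :=
    Module.Finite.iff_fg.2 (Submodule.fg_span (Set.finite_singleton x))
  refine (Module.jacobson_lt_top S (leftSpan x)).ne (eq_top_iff.2 ?_)
  obtain ⟨y, hy, hyx⟩ := h
  rintro ⟨z, hz⟩ -
  obtain ⟨c, rfl⟩ := Submodule.mem_span_singleton.1 hz
  convert! (Module.jacobson S (leftSpan x)).smul_mem c hy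
  exact congrArg (c • ·) hyx.symm

/-- `jacobsonMul` unfolds to `Ideal.map`, the span of an image; the image under a linear map is
already a submodule, so elements have the expected form. -/
theorem mem_jacobsonMul {S : Type*} [Ring S] {x z : S} :
    z ∈ jacobsonMul x ↔ ∃ j ∈ Ring.jacobson S, j * x = z := by
  have h : jacobsonMul x =
      Submodule.map (LinearMap.toSpanSingleton S S x) (Ring.jacobson S : Submodule S S) := by
    rw [jacobsonMul, Ideal.map, ← Submodule.map_coe]
    exact Submodule.span_eq _
  rw [h, Submodule.mem_map]
  rfl

end Jacobson

/-! ### The quotient by an arrow-radical ideal -/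

section ArrowRadical

variable {R : Type r} [CommRing R] {V : Type u} [Quiver.{v} V] [Fintype V]
  {I : Ideal (PathAlgebra R V)} [I.IsTwoSided]

theorem quotTriv_mul_self (x : V) : quotTriv I x * quotTriv I x = quotTriv I x := by
  rw [quotTriv, ← map_mul, triv_mul_triv_self]

theorem quotTriv_mul_of_ne {x y : V} (h : x ≠ y) : quotTriv I x * quotTriv I y = 0 := by
  rw [quotTriv, quotTriv, ← map_mul, triv_mul_triv_of_ne h, map_zero]

theorem completeOrthogonalIdempotents_quotTriv :
    CompleteOrthogonalIdempotents (quotTriv I) where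
  idem x := quotTriv_mul_self x
  ortho _ _ h := quotTriv_mul_of_ne h
  complete := by
    simp_rw [quotTriv]
    rw [← map_sum, ← PathAlgebra.one_def, map_one]

theorem quotArrow_mul_quotTriv_tail (a : QArrow V) :
    quotArrow I a * quotTriv I a.tail = quotArrow I a := by
  rw [quotArrow, quotTriv, ← map_mul, arrow_mul_triv_tail]

theorem quotArrow_mul_quotTriv_of_ne {a : QArrow V} {x : V} (h : a.tail ≠ x) :
    quotArrow I a * quotTriv I x = 0 := by
  rw [quotArrow, quotTriv, ← map_mul, arrow_mul_triv_of_ne h, map_zero]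

theorem quotTriv_head_mul_quotArrow (a : QArrow V) :
    quotTriv I a.head * quotArrow I a = quotArrow I a := by
  rw [quotArrow, quotTriv, ← map_mul, triv_head_mul_arrow]

variable (I) in
/-- The left ideal `∑ Λ a` of `Λ = RQ / I`, over the arrows `a` with tail `x`. -/
def arrowsFrom (x : V) : Submodule (PathAlgebra R V ⧸ I) (PathAlgebra R V ⧸ I) :=
  ⨆ (a : QArrow V) (_ : a.tail = x), leftSpan (quotArrow I a)

theorem quotArrow_mem_arrowsFrom (a : QArrow V) : quotArrow I a ∈ arrowsFrom I a.tail :=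
  Submodule.mem_iSup_of_mem a (Submodule.mem_iSup_of_mem rfl (Submodule.mem_span_singleton_self _))

variable (I) in
/-- The quotient map from the path algebra, as a linear map over the coefficient ring. -/
def quotLin : PathAlgebra R V →ₗ[R] PathAlgebra R V ⧸ I := (Ideal.Quotient.mkₐ R I).toLinearMap

theorem quotLin_apply (x : PathAlgebra R V) : quotLin I x = Ideal.Quotient.mk I x := rfl

theorem quotLin_triv (x : V) : quotLin I (triv R x) = quotTriv I x := rfl

theorem quotLin_arrow (a : QArrow V) : quotLin I (arrow R a) = quotArrow I a := rfl

theorem quotLin_surjective : Function.Surjective (quotLin I) := Ideal.Quotient.mk_surjective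

theorem arrowsFrom_le_map_arrowIdeal (x : V) {z : PathAlgebra R V ⧸ I} (hz : z ∈ arrowsFrom I x) :
    z ∈ (arrowIdeal R V).map (quotLin I) := by
  induction hz using Submodule.iSup_induction' with
  | zero => exact zero_mem _
  | add y z _ _ hy hz => exact add_mem hy hz
  | mem a z hz =>
    by_cases h : a.tail = x
    · simp only [h, iSup_pos] at hz
      obtain ⟨c, rfl⟩ := Submodule.mem_span_singleton.1 hz
      obtain ⟨c, rfl⟩ := Ideal.Quotient.mk_surjective c
      refine ⟨c * arrow R a, ?_, map_mul (Ideal.Quotient.mk I) _ _⟩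
      rw [arrowIdeal_eq_top_mul]
      exact Submodule.mul_mem_mul Submodule.mem_top (arrow_mem_pathsOfLength_one a)
    · simp only [h, iSup_false] at hz
      rw [(Submodule.mem_bot _).1 hz]
      exact zero_mem _

theorem exists_eq_sum_quotTriv_add (z : PathAlgebra R V ⧸ I) :
    ∃ c : V → R, ∃ y ∈ (arrowIdeal R V).map (quotLin I), z = ∑ x, c x • quotTriv I x + y := by
  obtain ⟨z, rfl⟩ := quotLin_surjective z
  obtain ⟨c, y, hy, rfl⟩ := exists_eq_sum_triv_add z
  refine ⟨c, quotLin I y, ⟨y, hy, rfl⟩, ?_⟩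
  simp_rw [map_add, map_sum, map_smul]
  rfl

theorem arrowsFrom_le_jacobson (hI : IsArrowRadical I) (x : V) :
    arrowsFrom I x ≤ Ring.jacobson (PathAlgebra R V ⧸ I) :=
  le_jacobson_of_isUniqueMaximalSubmodule (hI x).1

theorem quotArrow_mem_jacobson (hI : IsArrowRadical I) (a : QArrow V) :
    quotArrow I a ∈ Ring.jacobson (PathAlgebra R V ⧸ I) :=
  arrowsFrom_le_jacobson hI _ (quotArrow_mem_arrowsFrom a)

theorem map_arrowIdeal_le_jacobson (hI : IsArrowRadical I) {z : PathAlgebra R V ⧸ I}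
    (hz : z ∈ (arrowIdeal R V).map (quotLin I)) : z ∈ Ring.jacobson (PathAlgebra R V ⧸ I) := by
  obtain ⟨z, hz, rfl⟩ := hz
  rw [arrowIdeal_eq_top_mul, pathsOfLength_one_eq_span] at hz
  refine Submodule.mul_induction_on hz (fun s _ y hy => ?_) fun x y hx hy => ?_
  · rw [quotLin_apply, map_mul]
    refine Ideal.mul_mem_left _ _ ?_
    induction hy using Submodule.span_induction with
    | mem _ h => obtain ⟨a, rfl⟩ := h; exact quotArrow_mem_jacobson hI a
    | zero => rw [map_zero]; exact zero_mem _
    | add _ _ _ _ h h' => rw [map_add]; exact add_mem h h'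
    | smul c y _ h =>
      rw [← quotLin_apply, map_smul]
      exact Submodule.smul_of_tower_mem _ c h
  · rw [map_add]
    exact add_mem hx hy

theorem quotTriv_notMem_jacobson (hI : IsArrowRadical I) (x : V) :
    quotTriv I x ∉ Ring.jacobson (PathAlgebra R V ⧸ I) := by
  intro h
  have h0 := IsIdempotentElem.eq_zero_of_mem_jacobson (quotTriv_mul_self x) h
  have hlt := (((hI x).1 _).2 rfl).lt
  rw [h0, leftSpan, Submodule.span_zero_singleton] at hlt
  exact not_lt_bot hlt

/-- Each `a = a e_x` lies in `J e_x`. In the other direction, if `J e_x` were not contained in the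
maximal submodule, the two would add up to `Λ e_x` and put `e_x` in `J`. -/
theorem arrowsFrom_eq_jacobsonMul (hI : IsArrowRadical I) (x : V) :
    arrowsFrom I x = jacobsonMul (quotTriv I x) := by
  refine le_antisymm (iSup₂_le ?_) ?_
  · rintro a rfl
    rw [leftSpan, Submodule.span_singleton_le_iff_mem]
    exact mem_jacobsonMul.2 ⟨_, quotArrow_mem_jacobson hI a, quotArrow_mul_quotTriv_tail a⟩
  · have hcov : arrowsFrom I x ⋖ leftSpan (quotTriv I x) := ((hI x).1 _).2 rfl
    have hle : jacobsonMul (quotTriv I x) ≤ leftSpan (quotTriv I x) := by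
      intro z hz
      obtain ⟨j, -, rfl⟩ := mem_jacobsonMul.1 hz
      exact Submodule.smul_mem _ _ (Submodule.mem_span_singleton_self _)
    rcases hcov.eq_or_eq (c := arrowsFrom I x ⊔ jacobsonMul (quotTriv I x)) le_sup_left
      (sup_le hcov.le hle) with h | h
    · exact sup_eq_left.1 h
    · exfalso
      have hmem : quotTriv I x ∈ arrowsFrom I x ⊔ jacobsonMul (quotTriv I x) :=
        h ▸ Submodule.mem_span_singleton_self _
      refine quotTriv_notMem_jacobson hI x (sup_le (arrowsFrom_le_jacobson hI x) ?_ hmem)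
      intro z hz
      obtain ⟨j, hj, rfl⟩ := mem_jacobsonMul.1 hz
      exact Ideal.mul_mem_right _ _ hj

theorem isLocalIdempotent_quotTriv (hI : IsArrowRadical I) (x : V) :
    IsLocalIdempotent (quotTriv I x) :=
  ⟨quotTriv_mul_self x, arrowsFrom_eq_jacobsonMul hI x ▸ (hI x).1⟩

theorem smul_quotTriv_mul_quotTriv (c : V → R) (x : V) :
    (∑ y, c y • quotTriv I y) * quotTriv I x = c x • quotTriv I x := by
  rw [Finset.sum_mul, Finset.sum_eq_single x]
  · rw [smul_mul_assoc, quotTriv_mul_self]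
  · intro y _ hy
    rw [smul_mul_assoc, quotTriv_mul_of_ne hy, smul_zero]
  · exact fun h => absurd (Finset.mem_univ _) h

variable [IsLocalRing R]

theorem mem_maximalIdeal_of_smul_quotTriv_mem (hI : IsArrowRadical I) {x : V} {c : R}
    (h : c • quotTriv I x ∈ Ring.jacobson (PathAlgebra R V ⧸ I)) :
    c ∈ IsLocalRing.maximalIdeal R := by
  by_contra hc
  obtain ⟨c, rfl⟩ := IsLocalRing.notMem_maximalIdeal.1 hc
  refine quotTriv_notMem_jacobson hI x ?_
  have := Submodule.smul_of_tower_mem (Ring.jacobson (PathAlgebra R V ⧸ I)) (↑c⁻¹ : R) h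
  rwa [smul_smul, Units.inv_mul, one_smul] at this

/-- Otherwise `e_x` would be an element of `∑ Λ a` plus a multiple of `c e_x`; modulo `J` this reads
`(1 - c d) e_x = 0` for some `d` in `R`, although `1 - c d` is a unit. This is what places `𝔪Λ`
inside the radical. -/
theorem smul_quotTriv_mem_arrowsFrom (hI : IsArrowRadical I) (x : V) {c : R}
    (hc : c ∈ IsLocalRing.maximalIdeal R) : c • quotTriv I x ∈ arrowsFrom I x := by
  have hcov : arrowsFrom I x ⋖ leftSpan (quotTriv I x) := ((hI x).1 _).2 rfl
  have hle : leftSpan (c • quotTriv I x) ≤ leftSpan (quotTriv I x) := by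
    rw [leftSpan, Submodule.span_singleton_le_iff_mem]
    exact Submodule.smul_of_tower_mem _ c (Submodule.mem_span_singleton_self _)
  rcases hcov.eq_or_eq (c := arrowsFrom I x ⊔ leftSpan (c • quotTriv I x)) le_sup_left
    (sup_le hcov.le hle) with h | h
  · exact sup_eq_left.1 h (Submodule.mem_span_singleton_self _)
  · exfalso
    have hmem : quotTriv I x ∈ arrowsFrom I x ⊔ leftSpan (c • quotTriv I x) :=
      h ▸ Submodule.mem_span_singleton_self _
    obtain ⟨n, hn, w, hw, hnw⟩ := Submodule.mem_sup.1 hmem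
    obtain ⟨l, rfl⟩ := Submodule.mem_span_singleton.1 hw
    obtain ⟨d, y, hy, rfl⟩ := exists_eq_sum_quotTriv_add l
    have hy' := map_arrowIdeal_le_jacobson hI hy
    -- Modulo `J` the multiplier `l` is a combination of vertices, and only its coefficient at `x`
    -- survives multiplication by `e_x`.
    have key : (1 - c * d x) • quotTriv I x = n + c • (y * quotTriv I x) := by
      rw [sub_smul, one_smul, sub_eq_iff_eq_add]
      conv_lhs => rw [← hnw]
      rw [smul_eq_mul, mul_smul_comm, add_mul, smul_quotTriv_mul_quotTriv, smul_add, mul_smul]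
      abel
    have h1 := mem_maximalIdeal_of_smul_quotTriv_mem hI (x := x) (c := 1 - c * d x) <| by
      rw [key]
      exact add_mem (arrowsFrom_le_jacobson hI x hn)
        (Submodule.smul_of_tower_mem _ c (Ideal.mul_mem_right _ _ hy'))
    have h2 := add_mem h1 (Ideal.mul_mem_right (d x) _ hc)
    rw [sub_add_cancel] at h2
    exact (IsLocalRing.maximalIdeal.isMaximal R).ne_top ((Ideal.eq_top_iff_one _).2 h2)

theorem sum_smul_quotTriv_add_mem_jacobson_iff (hI : IsArrowRadical I) {c : V → R}
    {y : PathAlgebra R V ⧸ I} (hy : y ∈ Ring.jacobson (PathAlgebra R V ⧸ I)) :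
    ∑ x, c x • quotTriv I x + y ∈ Ring.jacobson (PathAlgebra R V ⧸ I) ↔
      ∀ x, c x ∈ IsLocalRing.maximalIdeal R := by
  rw [Submodule.add_mem_iff_left _ hy]
  refine ⟨fun h x => mem_maximalIdeal_of_smul_quotTriv_mem hI (x := x) ?_, fun h => ?_⟩
  · rw [← smul_quotTriv_mul_quotTriv]
    exact Ideal.mul_mem_right _ _ h
  · exact sum_mem fun x _ => arrowsFrom_le_jacobson hI x (smul_quotTriv_mem_arrowsFrom hI x (h x))

/-- The vertex coefficients of an element of `J` lie in `𝔪`, and `𝔪 e_x` is already covered by the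
arrows leaving `x`. -/
theorem mem_jacobson_iff_mem_map_arrowIdeal (hI : IsArrowRadical I) {z : PathAlgebra R V ⧸ I} :
    z ∈ Ring.jacobson (PathAlgebra R V ⧸ I) ↔ z ∈ (arrowIdeal R V).map (quotLin I) := by
  refine ⟨fun h => ?_, map_arrowIdeal_le_jacobson hI⟩
  obtain ⟨c, y, hy, rfl⟩ := exists_eq_sum_quotTriv_add z
  have hc := (sum_smul_quotTriv_add_mem_jacobson_iff hI (map_arrowIdeal_le_jacobson hI hy)).1 h
  exact add_mem (sum_mem fun x _ =>
    arrowsFrom_le_map_arrowIdeal x (smul_quotTriv_mem_arrowsFrom hI x (hc x))) hy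

theorem smul_mem_jacobson (hI : IsArrowRadical I) {c : R} (hc : c ∈ IsLocalRing.maximalIdeal R)
    (z : PathAlgebra R V ⧸ I) : c • z ∈ Ring.jacobson (PathAlgebra R V ⧸ I) := by
  rw [← mul_one z, ← completeOrthogonalIdempotents_quotTriv.complete, ← mul_smul_comm,
    Finset.smul_sum]
  exact Ideal.mul_mem_left _ _ (sum_mem fun x _ =>
    arrowsFrom_le_jacobson hI x (smul_quotTriv_mem_arrowsFrom hI x hc))

end ArrowRadical

/-! ### The semiperfect structure of the quotient -/

section Semiperfect

variable {R : Type r} [CommRing R] {V : Type u} [Quiver.{v} V] [Fintype V]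
  {I : Ideal (PathAlgebra R V)} [I.IsTwoSided]

variable (I) in
/-- The ring homomorphism `R^V → RQ / I` sending `c` to `∑ c_x e_x`. -/
def vertexHom : (V → R) →+* PathAlgebra R V ⧸ I where
  toFun c := ∑ x, c x • quotTriv I x
  map_zero' := by simp
  map_one' := by simpa using completeOrthogonalIdempotents_quotTriv.complete
  map_add' c d := by simp_rw [Pi.add_apply, add_smul, Finset.sum_add_distrib]
  map_mul' c d := by
    rw [Finset.mul_sum]
    refine Finset.sum_congr rfl fun x _ => ?_
    rw [mul_smul_comm, smul_quotTriv_mul_quotTriv, smul_smul, Pi.mul_apply, mul_comm]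

theorem vertexHom_apply (c : V → R) : vertexHom I c = ∑ x, c x • quotTriv I x := rfl

theorem exists_sub_vertexHom_mem_jacobson (hI : IsArrowRadical I) (z : PathAlgebra R V ⧸ I) :
    ∃ c : V → R, z - vertexHom I c ∈ Ring.jacobson (PathAlgebra R V ⧸ I) := by
  obtain ⟨c, y, hy, rfl⟩ := exists_eq_sum_quotTriv_add z
  exact ⟨c, by simpa [vertexHom_apply] using map_arrowIdeal_le_jacobson hI hy⟩

/-- The image of `e_x` under an isomorphism lies in `e_x Λ e_y`, which is inside `J` because `Λ/J`
is spanned by the orthogonal vertices. Being a left multiple of it, `e_y` would lie in `J`. -/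
theorem not_isomorphicIdempotents_quotTriv (hI : IsArrowRadical I) {x y : V} (hxy : x ≠ y) :
    ¬ IsomorphicIdempotents (quotTriv I x) (quotTriv I y) := by
  rintro ⟨φ⟩
  have hx : quotTriv I x ∈ leftSpan (quotTriv I x) := Submodule.mem_span_singleton_self _
  obtain ⟨z, hz⟩ := Submodule.mem_span_singleton.1 (φ ⟨_, hx⟩).2
  have hφ : quotTriv I x • φ ⟨_, hx⟩ = φ ⟨_, hx⟩ := by
    rw [← map_smul]
    exact congrArg φ (Subtype.ext (quotTriv_mul_self x))
  have hmem : ((φ ⟨_, hx⟩ : leftSpan (quotTriv I y)) : PathAlgebra R V ⧸ I) ∈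
      Ring.jacobson (PathAlgebra R V ⧸ I) := by
    rw [← hφ, Submodule.coe_smul, ← hz]
    obtain ⟨c, hc⟩ := exists_sub_vertexHom_mem_jacobson hI z
    have h : quotTriv I x • z • quotTriv I y =
        quotTriv I x * ((z - vertexHom I c) * quotTriv I y) := by
      rw [sub_mul, vertexHom_apply, smul_quotTriv_mul_quotTriv, mul_sub, mul_smul_comm,
        quotTriv_mul_of_ne hxy, smul_zero, sub_zero]
      rfl
    rw [h]
    exact Ideal.mul_mem_left _ _ (Ideal.mul_mem_right _ _ hc)
  obtain ⟨⟨w, hw⟩, hwy⟩ := φ.surjective ⟨_, Submodule.mem_span_singleton_self _⟩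
  obtain ⟨l, rfl⟩ := Submodule.mem_span_singleton.1 hw
  refine quotTriv_notMem_jacobson hI y ?_
  have h : quotTriv I y = l • ((φ ⟨_, hx⟩ : leftSpan (quotTriv I y)) : PathAlgebra R V ⧸ I) := by
    rw [← Submodule.coe_smul, ← map_smul]
    exact (congrArg Subtype.val hwy).symm
  rw [h]
  exact Ideal.mul_mem_left _ _ hmem

variable [IsLocalRing R]

theorem vertexHom_mem_jacobson_iff (hI : IsArrowRadical I) {c : V → R} :
    vertexHom I c ∈ Ring.jacobson (PathAlgebra R V ⧸ I) ↔
      ∀ x, c x ∈ IsLocalRing.maximalIdeal R := by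
  rw [← sum_smul_quotTriv_add_mem_jacobson_iff hI (zero_mem _), add_zero, vertexHom_apply]

theorem nonempty_quotient_jacobson_ringEquiv (hI : IsArrowRadical I) :
    Nonempty (((PathAlgebra R V ⧸ I) ⧸ Ring.jacobson (PathAlgebra R V ⧸ I)) ≃+*
      (V → IsLocalRing.ResidueField R)) := by
  let f := (Ideal.Quotient.mk (Ring.jacobson (PathAlgebra R V ⧸ I))).comp (vertexHom I)
  let g : (V → R) →+* (V → IsLocalRing.ResidueField R) :=
    RingHom.pi fun x => (IsLocalRing.residue R).comp (Pi.evalRingHom (fun _ => R) x)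
  have hf : Function.Surjective f := fun z => by
    obtain ⟨z, rfl⟩ := Ideal.Quotient.mk_surjective z
    obtain ⟨c, hc⟩ := exists_sub_vertexHom_mem_jacobson hI z
    exact ⟨c, (Ideal.Quotient.eq.2 hc).symm⟩
  have hg : Function.Surjective g := fun z => by
    choose c hc using fun x => IsLocalRing.residue_surjective (z x)
    exact ⟨c, funext hc⟩
  have hfg : RingHom.ker f = RingHom.ker g := by
    ext c
    rw [RingHom.mem_ker, RingHom.mem_ker, funext_iff, RingHom.comp_apply,
      Ideal.Quotient.eq_zero_iff_mem, vertexHom_mem_jacobson_iff hI]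
    exact forall_congr' fun x => (IsLocalRing.residue_eq_zero_iff _).symm
  exact ⟨(RingHom.quotientKerEquivOfSurjective hf).symm.trans
    ((Ideal.quotEquivOfEq hfg).trans (RingHom.quotientKerEquivOfSurjective hg))⟩

theorem isSemiperfectRing_quotient (hI : IsArrowRadical I) :
    IsSemiperfectRing (PathAlgebra R V ⧸ I) := by
  refine ⟨?_, fun z hz => ?_⟩
  · obtain ⟨e⟩ := nonempty_quotient_jacobson_ringEquiv hI
    exact e.symm.isSemisimpleRing
  · obtain ⟨c, hc⟩ := exists_sub_vertexHom_mem_jacobson hI z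
    have hcc : vertexHom I (c * c - c) ∈ Ring.jacobson (PathAlgebra R V ⧸ I) := by
      have h : vertexHom I (c * c - c) = (z * z - z) - (z - vertexHom I c) * z -
          vertexHom I c * (z - vertexHom I c) + (z - vertexHom I c) := by
        rw [map_sub, map_mul]
        noncomm_ring
      rw [h]
      exact add_mem
        (sub_mem (sub_mem hz (Ideal.mul_mem_right _ _ hc)) (Ideal.mul_mem_left _ _ hc)) hc
    rw [vertexHom_mem_jacobson_iff hI] at hcc
    -- Each `c x` is idempotent in the residue field, so it is congruent to `0` or `1`, and these
    -- are idempotents of `R` itself; no completeness is involved.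
    have hd : ∀ x, ∃ d : R, d * d = d ∧ c x - d ∈ IsLocalRing.maximalIdeal R := fun x => by
      have h : c x * (c x - 1) ∈ IsLocalRing.maximalIdeal R := by
        convert! hcc x using 1
        simp [mul_sub]
      rcases (IsLocalRing.maximalIdeal.isMaximal R).isPrime.mem_or_mem h with h | h
      · exact ⟨0, by simp, by simpa using h⟩
      · exact ⟨1, by simp, h⟩
    choose d hd hcd using hd
    refine ⟨vertexHom I d, ?_, ?_⟩
    · rw [IsIdempotentElem, ← map_mul]
      exact congrArg _ (funext hd)
    · have := add_mem hc ((vertexHom_mem_jacobson_iff hI (c := c - d)).2 hcd)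
      rwa [map_sub, sub_add_sub_cancel] at this

theorem isBasicRing_quotient (hI : IsArrowRadical I) :
    IsBasicRing (PathAlgebra R V ⧸ I) := by
  obtain ⟨e⟩ := nonempty_quotient_jacobson_ringEquiv hI
  -- `IsBasicRing` asks for division rings in the universe of `Λ`, which the residue field reaches
  -- only through `ULift`.
  refine ⟨Fintype.card V, fun _ => ULift.{max u v} (IsLocalRing.ResidueField R),
    fun _ => inferInstance, ⟨e.trans ?_⟩⟩
  exact (RingEquiv.piCongrRight fun _ => ULift.ringEquiv.symm).trans
    (RingEquiv.piCongrLeft (fun _ => ULift.{max u v} (IsLocalRing.ResidueField R))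
      (Fintype.equivFin V))

end Semiperfect

/-! ### Finite generation over the coefficient ring -/

section Finite

/-- The left ideal `𝔞 S` of an algebra `S`, for an ideal `𝔞` of the base ring. -/
def idealSMulTop {R : Type*} [CommRing R] (𝔞 : Ideal R) (S : Type*) [Ring S] [Algebra R S] :
    Submodule S S where
  carrier := (𝔞 • (⊤ : Submodule R S) : Submodule R S)
  zero_mem' := zero_mem _
  add_mem' h h' := add_mem h h'
  smul_mem' s x hx := by
    refine Submodule.smul_induction_on hx (fun c hc y _ => ?_) fun y z hy hz => ?_
    · rw [smul_eq_mul, mul_smul_comm]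
      exact Submodule.smul_mem_smul hc Submodule.mem_top
    · rw [smul_add]
      exact Submodule.add_mem _ hy hz

theorem mem_idealSMulTop {R : Type*} [CommRing R] {𝔞 : Ideal R} {S : Type*} [Ring S]
    [Algebra R S] {x : S} : x ∈ idealSMulTop 𝔞 S ↔ x ∈ 𝔞 • (⊤ : Submodule R S) := Iff.rfl

theorem isTorsionBySet_quotient_idealSMulTop {R : Type*} [CommRing R] (𝔞 : Ideal R)
    (S : Type*) [Ring S] [Algebra R S] :
    Module.IsTorsionBySet R (S ⧸ idealSMulTop 𝔞 S) (𝔞 : Set R) := by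
  intro x c
  obtain ⟨x, rfl⟩ := (idealSMulTop 𝔞 S).mkQ_surjective x
  have h : ((idealSMulTop 𝔞 S).mkQ.restrictScalars R) ((c : R) • x) = 0 :=
    (Submodule.Quotient.mk_eq_zero (idealSMulTop 𝔞 S)).2
      (mem_idealSMulTop.2 (Submodule.smul_mem_smul c.2 Submodule.mem_top))
  rwa [map_smul] at h

theorem isArtinian_of_isTorsionBySet_maximalIdeal {R : Type*} [CommRing R] [IsLocalRing R]
    {M : Type*} [AddCommGroup M] [Module R M] [Module.Finite R M]
    (hM : Module.IsTorsionBySet R M (IsLocalRing.maximalIdeal R : Set R)) : IsArtinian R M := by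
  let _ : Module (IsLocalRing.ResidueField R) M := hM.module
  have : IsScalarTower R (IsLocalRing.ResidueField R) M := hM.isScalarTower
  have : Module.Finite (IsLocalRing.ResidueField R) M :=
    Module.Finite.of_restrictScalars_finite R _ _
  exact isArtinian_of_surjective_algebraMap (R := IsLocalRing.ResidueField R)
    IsLocalRing.residue_surjective

/-- The descending chain stabilises, and Nakayama kills the stable value. -/
theorem exists_jacobson_smul_iterate_eq_bot (S M : Type*) [Ring S] [AddCommGroup M] [Module S M]
    [IsArtinian S M] [IsNoetherian S M] :
    ∃ m, (fun W : Submodule S M => Ring.jacobson S • W)^[m] ⊤ = ⊥ := by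
  set F : Submodule S M → Submodule S M := fun W => Ring.jacobson S • W
  have hanti : Antitone fun m => F^[m] ⊤ := antitone_nat_of_succ_le fun m => by
    rw [Function.iterate_succ_apply']
    exact Submodule.smul_le.2 fun c _ x hx => Submodule.smul_mem _ c hx
  obtain ⟨m, hm⟩ := IsArtinian.monotone_stabilizes
    (⟨fun m => OrderDual.toDual (F^[m] ⊤), fun _ _ h => hanti h⟩ : ℕ →o (Submodule S M)ᵒᵈ)
  refine ⟨m, Submodule.FG.eq_bot_of_le_jacobson_smul (IsNoetherian.noetherian _) ?_⟩
  have h : F^[m] ⊤ = F^[m + 1] ⊤ := hm (m + 1) (Nat.le_succ m)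
  rw [Function.iterate_succ_apply'] at h
  exact h.le

/-- Over a module-finite algebra over a local ring, the Jacobson radical is nilpotent modulo the
maximal ideal of the base. -/
theorem exists_pow_le_maximalIdeal_smul_top {R : Type*} [CommRing R] [IsNoetherianRing R]
    [IsLocalRing R] {S : Type*} [Ring S] [Algebra R S] [Module.Finite R S] {B : Submodule R S}
    (hB : ∀ z ∈ B, z ∈ Ring.jacobson S) :
    ∃ m, 0 < m ∧ B ^ m ≤ IsLocalRing.maximalIdeal R • (⊤ : Submodule R S) := by
  set K := idealSMulTop (IsLocalRing.maximalIdeal R) S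
  have : Module.Finite R (S ⧸ K) :=
    Module.Finite.of_surjective (K.mkQ.restrictScalars R) K.mkQ_surjective
  have : IsArtinian R (S ⧸ K) := isArtinian_of_isTorsionBySet_maximalIdeal
    (isTorsionBySet_quotient_idealSMulTop _ S)
  have : IsArtinian S (S ⧸ K) := isArtinian_of_tower R inferInstance
  have : IsNoetherian S (S ⧸ K) := isNoetherian_of_tower R inferInstance
  obtain ⟨m, hm⟩ := exists_jacobson_smul_iterate_eq_bot S (S ⧸ K)
  have key : ∀ n, ∀ x ∈ B ^ (n + 1),
      K.mkQ x ∈ (fun W : Submodule S (S ⧸ K) => Ring.jacobson S • W)^[n + 1] ⊤ := fun n => by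
    induction n with
    | zero =>
      intro x hx
      rw [zero_add, pow_one] at hx
      have h : K.mkQ x = x • K.mkQ 1 := by rw [← map_smul, smul_eq_mul, mul_one]
      rw [h]
      exact Submodule.smul_mem_smul (hB x hx) Submodule.mem_top
    | succ n ih =>
      intro x hx
      rw [pow_succ'] at hx
      rw [Function.iterate_succ_apply']
      refine Submodule.mul_induction_on hx (fun b hb y hy => ?_) fun y z hy hz => ?_
      · rw [← smul_eq_mul, map_smul]
        exact Submodule.smul_mem_smul (hB b hb) (ih y hy)
      · rw [map_add]
        exact add_mem hy hz
  -- One step beyond `m` makes the exponent positive; the iterate there is `J • ⊥`, still zero.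
  refine ⟨m + 1, Nat.succ_pos m, fun x hx => ?_⟩
  have h := key m x hx
  simp only [Function.iterate_succ_apply', hm, Submodule.smul_bot, Submodule.mem_bot] at h
  exact (Submodule.Quotient.mk_eq_zero K).1 h

/-! ### Finiteness of the quotient and boundedness below -/

variable {R : Type r} [CommRing R] {V : Type u} [Quiver.{v} V] [Fintype V]
  {I : Ideal (PathAlgebra R V)} [I.IsTwoSided]

theorem mem_sup_of_quotLin_mem_map {B : Submodule R (PathAlgebra R V)} {x : PathAlgebra R V}
    (h : quotLin I x ∈ B.map (quotLin I)) : x ∈ I.restrictScalars R ⊔ B := by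
  obtain ⟨y, hy, hyx⟩ := h
  refine Submodule.mem_sup.2 ⟨x - y, ?_, y, hy, sub_add_cancel x y⟩
  exact Ideal.Quotient.eq.1 hyx.symm

theorem map_quotLin_restrictScalars : (I.restrictScalars R).map (quotLin I) = ⊥ := by
  refine (Submodule.map_le_iff_le_comap.2 fun x hx => ?_).antisymm bot_le
  exact (Submodule.mem_bot R).2 (Ideal.Quotient.eq_zero_iff_mem.2 hx)

theorem iSup_pathsOfLength_fg [∀ x y : V, Fintype (x ⟶ y)] (s : Finset ℕ) :
    (⨆ l ∈ s, pathsOfLength R V l).FG :=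
  Submodule.fg_biSup s _ fun l _ => pathsOfLength_fg l

/-- Finitely generated submodules are compact elements of the lattice, so one stage of the
increasing chain of finite partial suprema suffices. -/
theorem exists_le_iSup_of_fg {M : Type*} [AddCommGroup M] [Module R M] {N : Submodule R M}
    (hN : N.FG) {B : ℕ → Submodule R M} (h : N ≤ ⨆ l ≥ 1, B l) :
    ∃ n, 0 < n ∧ N ≤ ⨆ l ∈ Finset.Icc 1 n, B l := by
  have hmono : Monotone fun n => ⨆ l ∈ Finset.Icc 1 n, B l := fun m n hmn =>
    biSup_mono fun l hl => by simp at hl ⊢; lia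
  have hle : N ≤ ⨆ n, ⨆ l ∈ Finset.Icc 1 n, B l := h.trans <| iSup₂_le fun l hl =>
    le_iSup_of_le l (le_iSup₂_of_le l (by simp; lia) le_rfl)
  obtain ⟨_, ⟨n, rfl⟩, hn⟩ := (Submodule.fg_iff_compact N).1 hN _ _ (Set.range_nonempty _)
    hmono.directed_le.directedOn_range isLUB_iSup hle
  exact ⟨n + 1, Nat.succ_pos n, hn.trans (hmono (Nat.le_succ n))⟩

variable [IsLocalRing R]

theorem map_maxCoeff : (maxCoeff R V).map (quotLin I) =
    IsLocalRing.maximalIdeal R • (⊤ : Submodule R (PathAlgebra R V ⧸ I)) := by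
  rw [maxCoeff_eq_smul_top, Submodule.map_smul'', Submodule.map_top,
    LinearMap.range_eq_top.2 quotLin_surjective]

theorem finite_of_isBoundedBelow [∀ x y : V, Fintype (x ⟶ y)] (h : IsBoundedBelow I) :
    Module.Finite R (PathAlgebra R V ⧸ I) := by
  obtain ⟨m, n, hm, -, hA, hM⟩ := h
  -- Paths shorter than `m` are listed directly; longer ones lie in `A^m ⊆ I + 𝔪Q`, and `𝔪Q` needs
  -- only lengths up to `n`. The range `m + n + 1` covers both.
  have htop : (⊤ : Submodule R (PathAlgebra R V)) ≤ I.restrictScalars R ⊔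
      ⨆ l ∈ Finset.range (m + n + 1), pathsOfLength R V l := by
    have hM' : maxCoeff R V ≤ I.restrictScalars R ⊔
        ⨆ l ∈ Finset.range (m + n + 1), pathsOfLength R V l :=
      hM.trans (sup_le_sup_left (biSup_mono fun l hl => by simp at hl ⊢; lia) _)
    rw [← iSup_pathsOfLength]
    refine iSup_le fun l => ?_
    rcases lt_or_ge l m with hl | hl
    · exact le_sup_of_le_right (le_iSup₂_of_le l (by simp; lia) le_rfl)
    · exact (pathsOfLength_le_arrowIdeal_pow hm hl).trans (hA.trans (sup_le le_sup_left hM'))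
  refine ⟨?_⟩
  have hmap := Submodule.map_mono (f := quotLin I) htop
  rw [Submodule.map_top, LinearMap.range_eq_top.2 quotLin_surjective, Submodule.map_sup,
    map_quotLin_restrictScalars, bot_sup_eq, top_le_iff] at hmap
  rw [← hmap]
  exact (iSup_pathsOfLength_fg _).map _

theorem isBoundedBelow_of_finite [IsNoetherianRing R] (hI : IsArrowRadical I)
    [Module.Finite R (PathAlgebra R V ⧸ I)] : IsBoundedBelow I := by
  obtain ⟨m, hm, hA⟩ := exists_pow_le_maximalIdeal_smul_top (R := R)
    (B := (arrowIdeal R V).map (quotLin I)) fun z hz => map_arrowIdeal_le_jacobson hI hz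
  -- `𝔪Λ` lies in `J`, the image of `A`, so trivial paths are not needed to express it.
  have hle : IsLocalRing.maximalIdeal R • (⊤ : Submodule R (PathAlgebra R V ⧸ I)) ≤
      ⨆ l ≥ 1, (pathsOfLength R V l).map (quotLin I) := by
    simp_rw [← Submodule.map_iSup]
    exact Submodule.smul_le.2 fun c hc z _ =>
      (mem_jacobson_iff_mem_map_arrowIdeal hI).1 (smul_mem_jacobson hI hc z)
  obtain ⟨n, hn, hM⟩ := exists_le_iSup_of_fg (IsNoetherian.noetherian _) hle
  refine ⟨m, n, hm, hn, fun x hx => mem_sup_of_quotLin_mem_map ?_,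
    fun x hx => mem_sup_of_quotLin_mem_map ?_⟩
  · rw [map_maxCoeff]
    refine hA ?_
    have := Submodule.mem_map_of_mem (f := quotLin I) hx
    rwa [quotLin, Submodule.map_pow] at this
  · simp_rw [Submodule.map_iSup]
    exact hM (map_maxCoeff (I := I) ▸ Submodule.mem_map_of_mem hx)

end Finite

/-! ### Radical layers and bounded ideals -/

section RadicalLayer

/-- A module over a local ring that is killed by the maximal ideal and generated by a finite
family, independent modulo the maximal ideal, has that family as a basis over the residue field. -/
theorem exists_residueField_linearEquiv {R : Type*} [CommRing R] [IsLocalRing R] {M : Type*}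
    [AddCommGroup M] [Module R M] {ι : Type*} [Fintype ι] (b : ι → M)
    (hM : Module.IsTorsionBySet R M (IsLocalRing.maximalIdeal R : Set R))
    (hspan : ∀ z : M, ∃ c : ι → R, ∑ i, c i • b i = z)
    (hind : ∀ c : ι → R, ∑ i, c i • b i = 0 → ∀ i, c i ∈ IsLocalRing.maximalIdeal R) :
    ∃ (_ : Module (IsLocalRing.ResidueField R) M)
      (_ : IsScalarTower R (IsLocalRing.ResidueField R) M),
      Nonempty (M ≃ₗ[IsLocalRing.ResidueField R]
        (Fin (Fintype.card ι) → IsLocalRing.ResidueField R)) := by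
  let _ : Module (IsLocalRing.ResidueField R) M := hM.module
  have hsmul : ∀ (c : R) (z : M), IsLocalRing.residue R c • z = c • z := fun _ _ => rfl
  refine ⟨hM.module, hM.isScalarTower, ?_⟩
  have hli : LinearIndependent (IsLocalRing.ResidueField R) b := by
    rw [Fintype.linearIndependent_iff]
    intro g hg i
    choose c hc using fun i => IsLocalRing.residue_surjective (g i)
    simp_rw [← hc, hsmul] at hg
    rw [← hc i]
    exact (IsLocalRing.residue_eq_zero_iff _).2 (hind c hg i)
  have hsp : ⊤ ≤ Submodule.span (IsLocalRing.ResidueField R) (Set.range b) := fun z _ => by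
    obtain ⟨c, rfl⟩ := hspan z
    refine sum_mem fun i _ => ?_
    rw [← hsmul]
    exact Submodule.smul_mem _ _ (Submodule.subset_span ⟨i, rfl⟩)
  exact ⟨((Module.Basis.mk hli hsp).reindex (Fintype.equivFin ι)).equivFun⟩

variable {R : Type r} [CommRing R] {V : Type u} [Quiver.{v} V] [Fintype V]
  {I : Ideal (PathAlgebra R V)} [I.IsTwoSided]

theorem quotLin_mem_jacobson_sq (hI : IsArrowRadical I) {y : PathAlgebra R V}
    (hy : y ∈ arrowIdeal R V * arrowIdeal R V) :
    quotLin I y ∈ Ring.jacobson (PathAlgebra R V ⧸ I) * Ring.jacobson (PathAlgebra R V ⧸ I) := by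
  refine Submodule.mul_induction_on hy (fun a ha b hb => ?_) fun a b ha hb => ?_
  · rw [quotLin_apply, map_mul]
    exact Ideal.mul_mem_mul (map_arrowIdeal_le_jacobson hI ⟨a, ha, rfl⟩)
      (map_arrowIdeal_le_jacobson hI ⟨b, hb, rfl⟩)
  · rw [map_add]
    exact add_mem ha hb

variable [IsLocalRing R]

/-- The first half of boundedness above is automatic: an element of `I` maps to `0`, which is in
`J`, so its vertex coefficients lie in `𝔪`. -/
theorem le_arrowIdeal_sup_maxCoeff (hI : IsArrowRadical I) :
    I.restrictScalars R ≤ arrowIdeal R V ⊔ maxCoeff R V := by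
  intro x hx
  obtain ⟨c, y, hy, rfl⟩ := exists_eq_sum_triv_add x
  have h0 : ∑ z, c z • quotTriv I z + quotLin I y = 0 := by
    have : quotLin I (∑ z, c z • triv R z + y) = 0 := Ideal.Quotient.eq_zero_iff_mem.2 hx
    simpa only [map_add, map_sum, map_smul, quotLin_triv] using this
  have hc := (sum_smul_quotTriv_add_mem_jacobson_iff hI
    (map_arrowIdeal_le_jacobson hI ⟨y, hy, rfl⟩)).1 (h0 ▸ zero_mem _)
  rw [add_comm]
  refine Submodule.add_mem_sup hy ?_
  rw [maxCoeff_eq_smul_top]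
  exact sum_mem fun z _ => Submodule.smul_mem_smul (hc z) Submodule.mem_top

theorem exists_quotLin_eq_of_mem_jacobson_sq (hI : IsArrowRadical I) {z : PathAlgebra R V ⧸ I}
    (hz : z ∈ Ring.jacobson (PathAlgebra R V ⧸ I) * Ring.jacobson (PathAlgebra R V ⧸ I)) :
    ∃ y ∈ arrowIdeal R V ^ 2, quotLin I y = z := by
  rw [pow_two]
  refine Submodule.smul_induction_on hz (fun a ha b hb => ?_) ?_
  · obtain ⟨a, ha', rfl⟩ := (mem_jacobson_iff_mem_map_arrowIdeal hI).1 ha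
    obtain ⟨b, hb', rfl⟩ := (mem_jacobson_iff_mem_map_arrowIdeal hI).1 hb
    exact ⟨a * b, Submodule.mul_mem_mul ha' hb', map_mul (Ideal.Quotient.mk I) a b⟩
  · rintro _ _ ⟨a, ha, rfl⟩ ⟨b, hb, rfl⟩
    exact ⟨a + b, add_mem ha hb, map_add _ a b⟩

/-- Subtracting a preimage `y` in `A²` of the element of `J²` leaves an element of `I ∩ A`, to which
boundedness above applies; the `A²` terms do not affect arrow coefficients. -/
theorem coeff_arrow_mem_maximalIdeal (hI : IsArrowRadical I) (hbd : IsBoundedAbove I)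
    {w : PathAlgebra R V} (hw : w ∈ arrowIdeal R V)
    (h : quotLin I w ∈
      Ring.jacobson (PathAlgebra R V ⧸ I) * Ring.jacobson (PathAlgebra R V ⧸ I)) (a : QArrow V) :
    w.coeff ⟨a.tail, a.head, a.hom.toPath⟩ ∈ IsLocalRing.maximalIdeal R := by
  obtain ⟨y, hy, hyw⟩ := exists_quotLin_eq_of_mem_jacobson_sq hI h
  have hyA : y ∈ arrowIdeal R V := by
    rw [pow_two] at hy
    exact arrowIdeal_mul_top_le ((mul_le_mul' le_rfl le_top : _ ≤ arrowIdeal R V * ⊤) hy)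
  obtain ⟨s, hs, t, ht, hst⟩ := Submodule.mem_sup.1
    (hbd.2 ⟨Ideal.Quotient.eq.1 hyw.symm, sub_mem hw hyA⟩)
  rw [eq_sub_iff_add_eq] at hst
  rw [← coeffLin_apply, ← hst, map_add, map_add, coeffLin_apply, coeffLin_apply, coeffLin_apply,
    coeff_arrow_eq_zero_of_mem_sq hs, coeff_arrow_eq_zero_of_mem_sq hy, zero_add, add_zero]
  exact ht.1 _

theorem isPermissible_of_isBoundedAbove (hI : IsArrowRadical I) (hbd : IsBoundedAbove I) :
    IsPermissible I := by
  intro a ha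
  have h := coeff_arrow_mem_maximalIdeal hI hbd
    (pathsOfLength_le_arrowIdeal le_rfl (arrow_mem_pathsOfLength_one a))
    (by rw [quotLin_apply, Ideal.Quotient.eq_zero_iff_mem.2 ha]; exact zero_mem _) a
  rw [coeff_arrow_self] at h
  exact (IsLocalRing.maximalIdeal.isMaximal R).ne_top ((Ideal.eq_top_iff_one _).2 h)

variable [∀ x y : V, Fintype (x ⟶ y)]

theorem isBoundedAbove_of_isPermissible (hI : IsArrowRadical I) (hd : IsArrowDistinct I)
    (hp : IsPermissible I) : IsBoundedAbove I := by
  classical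
  refine ⟨le_arrowIdeal_sup_maxCoeff hI, ?_⟩
  rintro x ⟨hxI, hxA⟩
  obtain ⟨c, y, hy, rfl⟩ := exists_eq_sum_arrow_add hxA
  suffices hc : ∀ a, c a ∈ IsLocalRing.maximalIdeal R by
    rw [add_comm]
    refine Submodule.add_mem_sup (pow_two (arrowIdeal R V) ▸ hy) (sum_mem fun a _ => ⟨?_, ?_⟩)
    · rw [maxCoeff_eq_smul_top]
      exact Submodule.smul_mem_smul (hc a) Submodule.mem_top
    · exact Submodule.smul_mem _ _
        (pathsOfLength_le_arrowIdeal le_rfl (arrow_mem_pathsOfLength_one a))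
  intro a
  by_contra hca
  have hu : IsUnit (c a) := IsLocalRing.notMem_maximalIdeal.1 hca
  obtain ⟨d, hd', rfl⟩ := exists_eq_sum_mul_arrow (arrowIdeal_mul_self_le hy)
  -- In `Λ` the relation becomes `∑ l b * b = 0`, using `A² ⊆ A A_1` to write the higher terms as `d
  -- b * b` with `d b` in `A`. So `l a` is a unit modulo `J`.
  let l : QArrow V → PathAlgebra R V ⧸ I := fun b => algebraMap R _ (c b) + quotLin I (d b)
  have hl : ∑ b, l b * quotArrow I b = 0 := by
    have : quotLin I (∑ b, c b • arrow R b + ∑ b, d b * arrow R b) = 0 :=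
      Ideal.Quotient.eq_zero_iff_mem.2 hxI
    rw [← this, map_add, map_sum, map_sum, ← Finset.sum_add_distrib]
    refine Finset.sum_congr rfl fun b _ => ?_
    rw [add_mul, map_smul, Algebra.smul_def]
    exact congrArg _ (map_mul (Ideal.Quotient.mk I) _ _).symm
  have hla : ∃ z, z * l a = 1 := by
    refine isUnit_of_sub_mem_jacobson (hu.map (algebraMap R (PathAlgebra R V ⧸ I))) ?_
    rw [sub_add_cancel_left]
    exact neg_mem (map_arrowIdeal_le_jacobson hI ⟨_, hd' a, rfl⟩)
  obtain ⟨z, hz⟩ := hla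
  have hmem : quotArrow I a ∈
      ⨆ (b : QArrow V) (_ : b ≠ a ∧ b.tail = a.tail), leftSpan (quotArrow I b) := by
    -- Right multiplication by the trivial path at the tail of `a` kills the arrows with another
    -- tail.
    have h1 : l a * quotArrow I a =
        -∑ b ∈ Finset.univ.erase a, l b * (quotArrow I b * quotTriv I a.tail) := by
      rw [eq_neg_iff_add_eq_zero]
      conv_lhs => enter [1]; rw [← quotArrow_mul_quotTriv_tail a]
      rw [Finset.add_sum_erase _ (fun b => l b * (quotArrow I b * quotTriv I a.tail))
        (Finset.mem_univ a)]
      simp_rw [← mul_assoc]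
      rw [← Finset.sum_mul, hl, zero_mul]
    rw [← one_mul (quotArrow I a), ← hz, mul_assoc, h1]
    refine Submodule.smul_mem _ z (neg_mem (sum_mem fun b hb => ?_))
    by_cases hb' : b.tail = a.tail
    · have h2 : quotArrow I b * quotTriv I a.tail = quotArrow I b := by
        rw [← hb', quotArrow_mul_quotTriv_tail]
      rw [h2]
      exact Submodule.smul_mem _ _ (Submodule.mem_iSup_of_mem b
        (Submodule.mem_iSup_of_mem ⟨Finset.ne_of_mem_erase hb, hb'⟩
          (Submodule.mem_span_singleton_self _)))
    · rw [quotArrow_mul_quotTriv_of_ne hb', mul_zero]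
      exact zero_mem _
  refine hp a (Ideal.Quotient.eq_zero_iff_mem.1 (eq_zero_of_mem_radicalOf_leftSpan ((hd a).1 ?_)))
  exact ⟨Submodule.mem_span_singleton_self _, hmem⟩

theorem exists_sub_sum_quotArrow_mem_jacobson_sq (hI : IsArrowRadical I)
    {z : PathAlgebra R V ⧸ I} (hz : z ∈ Ring.jacobson (PathAlgebra R V ⧸ I)) :
    ∃ c : QArrow V → R, z - ∑ a, c a • quotArrow I a ∈
      Ring.jacobson (PathAlgebra R V ⧸ I) * Ring.jacobson (PathAlgebra R V ⧸ I) := by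
  obtain ⟨z, hzA, rfl⟩ := (mem_jacobson_iff_mem_map_arrowIdeal hI).1 hz
  obtain ⟨c, y, hy, rfl⟩ := exists_eq_sum_arrow_add hzA
  refine ⟨c, ?_⟩
  have h : quotLin I (∑ a, c a • arrow R a + y) - ∑ a, c a • quotArrow I a = quotLin I y := by
    simp_rw [map_add, map_sum, map_smul]
    exact add_sub_cancel_left _ _
  rw [h]
  exact quotLin_mem_jacobson_sq hI hy

/-- The classes of the arrows form a basis: `𝔪Λ ⊆ J` makes `𝔪` kill `J/J²`, the splitting `A = A_1 +
A²` gives spanning, and `coeff_arrow_mem_maximalIdeal` gives independence. -/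
theorem exists_radicalLayer_linearEquiv (hI : IsArrowRadical I) (hbd : IsBoundedAbove I) :
    ∃ (_ : Module (IsLocalRing.ResidueField R) (RadicalLayer (PathAlgebra R V ⧸ I)))
      (_ : IsScalarTower R (IsLocalRing.ResidueField R) (RadicalLayer (PathAlgebra R V ⧸ I))),
      Nonempty (RadicalLayer (PathAlgebra R V ⧸ I) ≃ₗ[IsLocalRing.ResidueField R]
        (Fin (Fintype.card (QArrow V)) → IsLocalRing.ResidueField R)) := by
  set Λ := PathAlgebra R V ⧸ I
  set N := (Ring.jacobson Λ * Ring.jacobson Λ).submoduleOf (Ring.jacobson Λ)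
  let π : Ring.jacobson Λ →ₗ[R] RadicalLayer Λ := N.mkQ.restrictScalars R
  have hπ : Function.Surjective π := N.mkQ_surjective
  have hπ0 : ∀ z, π z = 0 ↔ (z : Λ) ∈ Ring.jacobson Λ * Ring.jacobson Λ := fun z =>
    Submodule.Quotient.mk_eq_zero N
  let q : QArrow V → Ring.jacobson Λ := fun a => ⟨quotArrow I a, quotArrow_mem_jacobson hI a⟩
  have hq : ∀ c : QArrow V → R, ((∑ a, c a • q a : Ring.jacobson Λ) : Λ) =
      ∑ a, c a • quotArrow I a := fun c => by
    rw [AddSubmonoidClass.coe_finsetSum]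
    rfl
  refine exists_residueField_linearEquiv (fun a => π (q a)) ?_ (fun z => ?_) fun c hc a => ?_
  · intro z c
    obtain ⟨z, rfl⟩ := hπ z
    have : π ((c : R) • z) = 0 := by
      rw [hπ0]
      have h : (((c : R) • z : Ring.jacobson Λ) : Λ) = ((c : R) • (1 : Λ)) * z := by
        rw [smul_mul_assoc, one_mul]
        rfl
      rw [h]
      exact Ideal.mul_mem_mul (smul_mem_jacobson hI c.2 1) z.2
    rwa [map_smul] at this
  · obtain ⟨z, rfl⟩ := hπ z
    obtain ⟨c, hc⟩ := exists_sub_sum_quotArrow_mem_jacobson_sq hI z.2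
    refine ⟨c, ?_⟩
    simp_rw [← map_smul, ← map_sum]
    rw [eq_comm, ← sub_eq_zero, ← map_sub, hπ0]
    convert! hc using 1
    rw [← hq]
    rfl
  · simp_rw [← map_smul, ← map_sum] at hc
    rw [hπ0, hq] at hc
    have h := coeff_arrow_mem_maximalIdeal hI hbd (w := ∑ a, c a • arrow R a)
      (sum_mem fun a _ => Submodule.smul_mem _ _
        (pathsOfLength_le_arrowIdeal le_rfl (arrow_mem_pathsOfLength_one a)))
      (by simpa only [map_sum, map_smul, quotLin_arrow] using hc) a
    rwa [coeff_sum_arrow] at h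

end RadicalLayer

/-! ### The Gabriel quiver -/

section Gabriel

/-! ### Projectivity and Nakayama over a general ring -/

section Modules

variable {S : Type*} [Ring S]

/-- Right multiplication by `e` retracts the free module `S` onto `S e`. -/
theorem projective_leftSpan {e : S} (he : IsIdempotentElem e) :
    Module.Projective S (leftSpan e) := by
  refine Module.Projective.of_split (leftSpan e).subtype
    ((LinearMap.toSpanSingleton S S e).codRestrict (leftSpan e) fun s =>
      Submodule.smul_mem _ s (Submodule.mem_span_singleton_self e)) ?_
  ext ⟨z, hz⟩
  obtain ⟨s, rfl⟩ := Submodule.mem_span_singleton.1 hz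
  change s * e * e = s * e
  rw [mul_assoc, he.eq]

theorem projective_pi {ι : Type*} [Fintype ι] (M : ι → Type*) [∀ i, AddCommGroup (M i)]
    [∀ i, Module S (M i)] [∀ i, Module.Projective S (M i)] : Module.Projective S (∀ i, M i) := by
  classical
  exact Module.Projective.of_equiv (DirectSum.linearEquivFunOnFintype S ι M)

theorem finite_leftSpan (x : S) : Module.Finite S (leftSpan x) :=
  Module.Finite.iff_fg.2 (Submodule.fg_span (Set.finite_singleton x))

theorem mem_smul_top_pi {ι : Type*} [Fintype ι] {M : ι → Type*} [∀ i, AddCommGroup (M i)]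
    [∀ i, Module S (M i)] {J : Ideal S} {p : ∀ i, M i}
    (hp : ∀ i, p i ∈ J • (⊤ : Submodule S (M i))) : p ∈ J • (⊤ : Submodule S (∀ i, M i)) := by
  classical
  rw [← Finset.univ_sum_single p]
  refine sum_mem fun i _ => ?_
  have h := Submodule.mem_map_of_mem (f := LinearMap.single S M i) (hp i)
  rw [Submodule.map_smul''] at h
  exact (smul_mono_right J le_top : _ ≤ J • (⊤ : Submodule S (∀ i, M i))) h

/-- Since `z = z e`, membership of `z` in `J` already exhibits it as an element of `J` times the
generator. -/
theorem mem_smul_top_leftSpan {J : Ideal S} {e : S} (he : IsIdempotentElem e) {z : leftSpan e}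
    (hz : (z : S) ∈ J) : z ∈ J • (⊤ : Submodule S (leftSpan e)) := by
  have h : z = (z : S) • (⟨e, Submodule.mem_span_singleton_self e⟩ : leftSpan e) := by
    obtain ⟨z, hz'⟩ := z
    obtain ⟨s, rfl⟩ := Submodule.mem_span_singleton.1 hz'
    exact Subtype.ext (by simp [mul_assoc, he.eq])
  rw [h]
  exact Submodule.smul_mem_smul hz Submodule.mem_top

/-- A proper `N` in a finite module lies under a maximal submodule, which contains `J M` and hence
`K` as well. It supplies the superfluous kernel of the projective cover. -/
theorem eq_top_of_sup_eq_top_of_le_jacobson_smul {M : Type*} [AddCommGroup M] [Module S M]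
    [Module.Finite S M] {K N : Submodule S M} (hK : K ≤ Ring.jacobson S • (⊤ : Submodule S M))
    (h : K ⊔ N = ⊤) : N = ⊤ := by
  rcases eq_top_or_exists_le_coatom N with hN | ⟨L, hL, hNL⟩
  · exact hN
  · exact absurd (top_le_iff.1 (h ▸ sup_le ((hK.trans (Ring.jacobson_smul_top_le S M)).trans
      (sInf_le hL)) hNL)) hL.1

end Modules

/-! ### The projective cover of `J e_x` given by the arrows leaving `x` -/

variable {R : Type r} [CommRing R] {V : Type u} [Quiver.{v} V] [Fintype V]
  [∀ x y : V, Fintype (x ⟶ y)] {I : Ideal (PathAlgebra R V)} [I.IsTwoSided]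

open Classical in
variable (I) in
/-- The map `⨁ Λ e_y → Λ`, over all arrows `a : x ⟶ y`, given by right multiplication by `a` on the
summand of `a`. -/
def arrowsMap (x : V) :
    ((y : V) → (x ⟶ y) → leftSpan (quotTriv I y)) →ₗ[PathAlgebra R V ⧸ I] PathAlgebra R V ⧸ I :=
  -- `ℕ` is the auxiliary scalar ring of `LinearMap.lsum`; it has to commute with the action of the
  -- noncommutative ring `Λ`.
  LinearMap.lsum _ _ ℕ fun y => LinearMap.lsum _ _ ℕ fun a : x ⟶ y =>
    (LinearMap.toSpanSingleton _ _ (quotArrow I ⟨x, y, a⟩)).comp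
      (leftSpan (quotTriv I y)).subtype

theorem arrowsMap_apply (x : V) (p : (y : V) → (x ⟶ y) → leftSpan (quotTriv I y)) :
    arrowsMap I x p =
      ∑ y, ∑ a : x ⟶ y, (p y a : PathAlgebra R V ⧸ I) * quotArrow I ⟨x, y, a⟩ := by
  simp [arrowsMap, LinearMap.lsum_apply]

theorem range_arrowsMap (x : V) : LinearMap.range (arrowsMap I x) = arrowsFrom I x := by
  classical
  refine le_antisymm ?_ (iSup₂_le ?_)
  · rintro _ ⟨p, rfl⟩
    rw [arrowsMap_apply]
    exact sum_mem fun y _ => sum_mem fun a _ =>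
      Submodule.smul_mem _ _ (quotArrow_mem_arrowsFrom (I := I) ⟨x, y, a⟩)
  · rintro ⟨_, y, a⟩ rfl
    rw [leftSpan, Submodule.span_singleton_le_iff_mem]
    refine ⟨Pi.single y (Pi.single a ⟨quotTriv I y, Submodule.mem_span_singleton_self _⟩), ?_⟩
    rw [arrowsMap, LinearMap.lsum_piSingle, LinearMap.lsum_piSingle]
    exact quotTriv_head_mul_quotArrow (I := I) ⟨_, y, a⟩

variable [IsLocalRing R]

/-- Modulo `J`, the component of a kernel element at `a : x ⟶ y` is a scalar `c` times `e_y`. The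
relation then puts the combination of arrows with these scalars in `J²`, so the scalars lie in `𝔪`
and every component lies in `J`. -/
theorem ker_arrowsMap_le (hI : IsArrowRadical I) (hbd : IsBoundedAbove I) (x : V) :
    LinearMap.ker (arrowsMap I x) ≤ Ring.jacobson (PathAlgebra R V ⧸ I) •
      (⊤ : Submodule _ ((y : V) → (x ⟶ y) → leftSpan (quotTriv I y))) := by
  intro p hp
  have hc : ∀ y (a : x ⟶ y), ∃ c : R, (p y a : PathAlgebra R V ⧸ I) - c • quotTriv I y ∈
      Ring.jacobson (PathAlgebra R V ⧸ I) := fun y a => by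
    obtain ⟨l, hl⟩ := Submodule.mem_span_singleton.1 (p y a).2
    obtain ⟨c, hc⟩ := exists_sub_vertexHom_mem_jacobson hI l
    refine ⟨c y, ?_⟩
    rw [← hl, ← smul_quotTriv_mul_quotTriv, smul_eq_mul, ← sub_mul]
    exact Ideal.mul_mem_right _ _ hc
  choose c hc using hc
  let w : PathAlgebra R V := ∑ y, ∑ a : x ⟶ y, c y a • arrow R ⟨x, y, a⟩
  have hwA : w ∈ arrowIdeal R V := sum_mem fun y _ => sum_mem fun a _ =>
    Submodule.smul_mem _ _ (pathsOfLength_le_arrowIdeal le_rfl (arrow_mem_pathsOfLength_one _))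
  have hw : quotLin I w ∈
      Ring.jacobson (PathAlgebra R V ⧸ I) * Ring.jacobson (PathAlgebra R V ⧸ I) := by
    -- Subtracting the relation `∑ p y a * a = 0` leaves only products of an element of `J` with an
    -- arrow.
    have h : quotLin I w = -∑ y, ∑ a : x ⟶ y,
        ((p y a : PathAlgebra R V ⧸ I) - c y a • quotTriv I y) * quotArrow I ⟨x, y, a⟩ := by
      rw [eq_neg_iff_add_eq_zero, ← (LinearMap.mem_ker.1 hp : arrowsMap I x p = 0),
        arrowsMap_apply, map_sum, ← Finset.sum_add_distrib]
      refine Finset.sum_congr rfl fun y _ => ?_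
      rw [map_sum, ← Finset.sum_add_distrib]
      refine Finset.sum_congr rfl fun a _ => ?_
      rw [sub_mul, smul_mul_assoc, quotTriv_head_mul_quotArrow (I := I) ⟨x, y, a⟩, map_smul,
        quotLin_arrow, add_sub_cancel]
    rw [h]
    exact neg_mem (sum_mem fun y _ => sum_mem fun a _ =>
      Ideal.mul_mem_mul (hc y a) (quotArrow_mem_jacobson hI _))
  have hcm : ∀ y (a : x ⟶ y), c y a ∈ IsLocalRing.maximalIdeal R := fun y a => by
    have h := coeff_arrow_mem_maximalIdeal hI hbd hwA hw ⟨x, y, a⟩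
    rw [← coeffLin_apply, map_sum, Finset.sum_eq_single y, map_sum, Finset.sum_eq_single a,
      map_smul, coeffLin_apply, coeff_arrow_self ⟨x, y, a⟩, smul_eq_mul, mul_one] at h
    · exact h
    · intro b _ hb
      rw [map_smul, coeffLin_apply, coeff_arrow_of_ne (a := ⟨x, y, a⟩), smul_zero]
      simpa using hb
    · exact fun h => absurd (Finset.mem_univ _) h
    · intro z _ hz
      rw [map_sum]
      refine Finset.sum_eq_zero fun b _ => ?_
      rw [map_smul, coeffLin_apply, coeff_arrow_of_ne (a := ⟨x, y, a⟩), smul_zero]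
      exact fun h => hz (congrArg QArrow.head h)
    · exact fun h => absurd (Finset.mem_univ _) h
  refine mem_smul_top_pi fun y => mem_smul_top_pi fun a =>
    mem_smul_top_leftSpan (quotTriv_mul_self y) ?_
  have := add_mem (hc y a) (smul_mem_jacobson hI (hcm y a) (quotTriv I y))
  rwa [sub_add_cancel] at this

theorem isGabrielQuiver_quotient (hI : IsArrowRadical I) (hbd : IsBoundedAbove I) :
    IsGabrielQuiver (PathAlgebra R V ⧸ I) V := by
  refine ⟨isSemiperfectRing_quotient hI, isBasicRing_quotient hI, quotTriv I,
    completeOrthogonalIdempotents_quotTriv, isLocalIdempotent_quotTriv hI, fun x => ?_⟩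
  have hrange : LinearMap.range (arrowsMap I x) = jacobsonMul (quotTriv I x) :=
    (range_arrowsMap x).trans (arrowsFrom_eq_jacobsonMul hI x)
  have : ∀ y, Module.Projective (PathAlgebra R V ⧸ I) (leftSpan (quotTriv I y)) := fun y =>
    projective_leftSpan (quotTriv_mul_self y)
  have : ∀ y, Module.Finite (PathAlgebra R V ⧸ I) (leftSpan (quotTriv I y)) := fun y =>
    finite_leftSpan _
  have : ∀ y, Module.Projective (PathAlgebra R V ⧸ I) ((x ⟶ y) → leftSpan (quotTriv I y)) :=
    fun y => projective_pi _
  refine ⟨(arrowsMap I x).codRestrict _ fun p => hrange ▸ ⟨p, rfl⟩, projective_pi _, ?_, ?_⟩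
  · rintro ⟨z, hz⟩
    rw [← hrange] at hz
    obtain ⟨p, rfl⟩ := hz
    exact ⟨p, rfl⟩
  · intro N hN
    rw [LinearMap.ker_codRestrict] at hN
    exact eq_top_of_sup_eq_top_of_le_jacobson_smul (ker_arrowsMap_le hI hbd x) hN

end Gabriel

end

theorem theorem1p2 {R : Type r} [CommRing R] [IsNoetherianRing R] [IsLocalRing R]
    {V : Type u} [Quiver.{v} V] [Fintype V] [∀ x y : V, Fintype (x ⟶ y)]
    (I : Ideal (PathAlgebra R V)) [I.IsTwoSided] (hI : IsArrowRadical I) :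
    (IsSemiperfectRing (PathAlgebra R V ⧸ I) ∧ IsBasicRing (PathAlgebra R V ⧸ I) ∧
      CompleteOrthogonalIdempotents (quotTriv I) ∧
      (∀ x : V, IsLocalIdempotent (quotTriv I x)) ∧
      (∀ x y : V, x ≠ y → ¬ IsomorphicIdempotents (quotTriv I x) (quotTriv I y))) ∧
    (Module.Finite R (PathAlgebra R V ⧸ I) ↔ IsBoundedBelow I) ∧
    (IsArrowDistinct I → (IsPermissible I ↔ IsBoundedAbove I)) ∧
    (IsBoundedAbove I →
      Nonempty (((PathAlgebra R V ⧸ I) ⧸ Ring.jacobson (PathAlgebra R V ⧸ I)) ≃+*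
        (Fin (Fintype.card V) → IsLocalRing.ResidueField R)) ∧
      ∃ (_ : Module (IsLocalRing.ResidueField R) (RadicalLayer (PathAlgebra R V ⧸ I)))
        (_ : IsScalarTower R (IsLocalRing.ResidueField R) (RadicalLayer (PathAlgebra R V ⧸ I))),
        Nonempty (RadicalLayer (PathAlgebra R V ⧸ I) ≃ₗ[IsLocalRing.ResidueField R]
          (Fin (Fintype.card (QArrow V)) → IsLocalRing.ResidueField R))) ∧
    (IsAdmissibleIdeal I → IsAdicComplete (IsLocalRing.maximalIdeal R) R →
      IsGabrielQuiver (PathAlgebra R V ⧸ I) V) := by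
  refine ⟨⟨isSemiperfectRing_quotient hI, isBasicRing_quotient hI,
    completeOrthogonalIdempotents_quotTriv, isLocalIdempotent_quotTriv hI,
    fun x y => not_isomorphicIdempotents_quotTriv hI⟩,
    ⟨fun _ => isBoundedBelow_of_finite hI, finite_of_isBoundedBelow⟩,
    fun hd => ⟨isBoundedAbove_of_isPermissible hI hd, isPermissible_of_isBoundedAbove hI⟩,
    fun hbd => ⟨?_, exists_radicalLayer_linearEquiv hI hbd⟩,
    fun hadm _ => isGabrielQuiver_quotient hI hadm.1⟩
  obtain ⟨e⟩ := nonempty_quotient_jacobson_ringEquiv hI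
  exact ⟨e.trans (RingEquiv.piCongrLeft (fun _ => IsLocalRing.ResidueField R)
    (Fintype.equivFin V))⟩
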